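/- **Setting.** Let $\Omega$ be a countable state space, $\mathcal F$ a countable family of subsets of $\Omega$ (*flaws*), and $\mu$ a probability distribution on $\Omega$. For each flaw $f$ and state $\sigma\in f$ let $\mathfrak R_f(\sigma)$ be a random state, and put $A_f[\sigma,\tau]=\Pr(\mathfrak R_f(\sigma)=\tau)$ for $\sigma\in f$ and $A_f[\sigma,\tau]=0$ for $\sigma\notin f$. Let $\sim$ be a symmetric reflexive relation on $\mathcal F$ such that, for distinct $f\not\sim g$, $\mathfrak R_f$ never maps a state of $\Omega\setminus g$ into $g$, and $\mathfrak R_g$ never maps a state of $\Omega\setminus f$ into $f$. Assume T-commutativity: $A_fA_g=A_gA_f$ whenever $f\not\sim g$. The *local search algorithm* draws a state $\sigma$ from $\mu$ and, while some flaw holds on $\sigma$, selects a flaw $f\ni\sigma$ (by any rule, possibly randomized and depending on the history, but not on the fresh randomness of the resampling) and replaces $\sigma$ by $\mathfrak R_f(\sigma)$. For $E\subseteq\Omega$ let $P(E)$ be the probability that the state lies in $E$ at some time of the execution (including time $0$), and let $e_E$ be the indicator column vector of $E$. **Definitions.** Put $\overline\Gamma(f)=\{g: f\sim g\}$ and $\Gamma(f)=\overline\Gamma(f)\setminus\{f\}$.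 A set $I\subseteq\mathcal F$ is *stable* if $f\not\sim g$ for all distinct $f,g\in I$. A *wdag* is a finite directed acyclic graph $H$ with vertex labels $L(v)\in\mathcal F$, considered up to isomorphism, such that distinct vertices $v,w$ are joined by an edge (in one of the two directions) iff $L(v)\sim L(w)$; $\mathrm{sink}(H)$ is the set of labels of its sinks, and $\mathfrak W(I)$ is the set of wdags with $\mathrm{sink}(H)=I$. Put $A_\emptyset=\mathrm{Id}$ and $A_H=A_{L(v)}A_{H-v}$ for any source $v$ of $H$ (by T-commutativity the choice does not matter). Let $\tilde\Gamma(E)$ be the set of flaws $f$ with $A_f[\sigma',\sigma]>0$ for some $\sigma'\notin E$, $\sigma\in E$. A finite set $I\subseteq\tilde\Gamma(E)$ is *orderable for $E$* if it has an enumeration $I=\{g_1,\dots,g_r\}$ such that for every $i=1,\dots,r$ the entrywise inequality $A_{g_i}A_{g_{i+1}}\cdots A_{g_r}e_E\preceq A_{g_{i+1}}\cdots A_{g_r}e_E$ fails. Let $\mathfrak I(E)$ be the collection of stable sets orderable for $E$. The *charge* of $f$ is $$\gamma_f=\sup_{\tau\in\Omega}\ \sum_{\sigma\in f}\frac{\mu(\sigma)}{\mu(\tau)}A_f[\sigma,\tau]\in[0,\infty],$$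 where, for $\mu(\tau)=0$, a term with $\mu(\sigma)A_f[\sigma,\tau]=0$ counts as $0$ and any other term as $\infty$. Put $w(H)=\prod_{v\in H}\gamma_{L(v)}$, $\Psi(I)=\sum_{H\in\mathfrak W(I)}w(H)$ and $\overline\Psi(I)=\sum_{J\subseteq I}\Psi(J)$ ($J$ finite). All sums and products take values in $[0,\infty]$, with $0\cdot\infty=0$ and $e^\infty=\infty$. **Theorem.** For every $E\subseteq\Omega$ and every selection rule: 1. $\displaystyle P(E)\le\sum_{I\in\mathfrak I(E)}\ \sum_{H\in\mathfrak W(I)}\mu^\top A_He_E .$ 2. If no resampling leads from a state $\sigma$ with $\mu(\sigma)>0$ to a state $\tau$ with $\mu(\tau)=0$ (for instance if $\mu>0$ everywhere), then $$P(E)\le\mu(E)\sum_{I\in\mathfrak I(E)}\Psi(I)\le\mu(E)\,\overline\Psi(\tilde\Gamma(E)).$$ 3. (Symmetric criterion) If $p,d\ge0$ are real with $e\,p\,d\le1$, and $\gamma_f\le p$ and $|\overline\Gamma(f)|\le d$ for all $f$, then $P(E)\le\mu(E)\,e^{e|\tilde\Gamma(E)|p}$. 4. (Neighborhood bound) If $\sum_{g\in\overline\Gamma(f)}\gamma_g\le\frac14$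 for all $f$, then $P(E)\le\mu(E)\,e^{4\sum_{f\in\tilde\Gamma(E)}\gamma_f}$. 5. (Asymmetric criterion) If $x:\mathcal F\to[0,1)$ satisfies $\gamma_f\le x(f)\prod_{g\in\Gamma(f)}(1-x(g))$ for all $f$, then $P(E)\le\mu(E)\prod_{f\in\tilde\Gamma(E)}\frac1{1-x(f)}$. 6. (Cluster expansion) If $\eta:\mathcal F\to[0,\infty)$ satisfies $\eta(f)\ge\gamma_f\sum_{I}\prod_{g\in I}\eta(g)$ for all $f$, where $I$ ranges over the finite stable subsets of $\overline\Gamma(f)$, then $P(E)\le\mu(E)\sum_{I\in\mathfrak I(E)}\prod_{g\in I}\eta(g)$. -/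

import Mathlib

open MeasureTheory
open scoped ENNReal NNReal

noncomputable section

/-- The data of the general local search algorithm: a family of flaws (subsets of the state
space `Ω`, indexed by `𝓕`), a randomized resampling oracle for every flaw, an initial
distribution, and an undirected dependency relation on the flaws. Only the values of
`oracle f σ` with `σ ∈ flaw f` matter. -/
structure LocalSearch (Ω 𝓕 : Type*) where
  /-- the set of states on which a flaw holds -/
  flaw : 𝓕 → Set Ω
  /-- the law of the new state when flaw `f` is resampled at state `σ` -/
  oracle : 𝓕 → Ω → PMF Ω
  /-- the initial distribution -/
  μ : PMF Ω
  /-- the dependency relation `f ∼ g` -/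
  rel : 𝓕 → 𝓕 → Prop
  rel_refl : ∀ f, rel f f
  rel_symm : ∀ f g, rel f g → rel g f
  /-- if `f ≁ g`, then resampling `f` cannot introduce `g` (nor vice versa, by symmetry) -/
  not_cause : ∀ f g, f ≠ g → ¬ rel f g →
    ∀ σ ∈ flaw f, σ ∉ flaw g → ∀ τ ∈ flaw g, oracle f σ τ = 0

namespace LocalSearch

variable {Ω 𝓕 : Type*}

/-! ### Matrices and vectors over the (possibly infinite) state space -/

/-- Product of two nonnegative `Ω × Ω` matrices. -/
def mulMat (M N : Ω → Ω → ℝ≥0∞) : Ω → Ω → ℝ≥0∞ := fun σ τ => ∑' ρ, M σ ρ * N ρ τ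

/-- The identity matrix. -/
def idMat : Ω → Ω → ℝ≥0∞ := fun σ => Set.indicator {σ} (fun _ => 1)

/-- Matrix times column vector. -/
def mulCol (M : Ω → Ω → ℝ≥0∞) (v : Ω → ℝ≥0∞) : Ω → ℝ≥0∞ := fun σ => ∑' τ, M σ τ * v τ

/-- The indicator vector `e_E`. -/
def eVec (E : Set Ω) : Ω → ℝ≥0∞ := Set.indicator E (fun _ => 1)

/-- The transition matrix `A_f`; its rows outside the flaw are zero. -/
def A (S : LocalSearch Ω 𝓕) (f : 𝓕) : Ω → Ω → ℝ≥0∞ := fun σ τ =>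
  Set.indicator (S.flaw f) (fun σ => S.oracle f σ τ) σ

/-- T-commutativity. -/
def TCommutative (S : LocalSearch Ω 𝓕) : Prop :=
  ∀ f g, ¬ S.rel f g → mulMat (S.A f) (S.A g) = mulMat (S.A g) (S.A f)

/-- `Γ̄(f)`, the inclusive neighborhood. -/
def nbrIncl (S : LocalSearch Ω 𝓕) (f : 𝓕) : Set 𝓕 := {g | S.rel f g}

/-- `Γ(f)`, the exclusive neighborhood. -/
def nbr (S : LocalSearch Ω 𝓕) (f : 𝓕) : Set 𝓕 := S.nbrIncl f \ {f}

/-- Stable sets of flaws. -/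
def Stable (S : LocalSearch Ω 𝓕) (I : Finset 𝓕) : Prop :=
  ∀ f ∈ I, ∀ g ∈ I, f ≠ g → ¬ S.rel f g

/-! ### Executions of the algorithm -/

/-- `(X, F)` is an execution of the local search algorithm on the probability space `(Θ, P)`:
`X t` is the state at time `t` and `F t` is the flaw selected at time `t` (`none` once the
algorithm has stopped). The selected flaw holds in the current state, the algorithm stops only
at flawless states (and then the state stays what it is), and, given the whole history up to
and including the selection of a flaw `g` at time `t`, the next state has law `R_g (X t)`.
Nothing else is demanded of the selection, so the rule may depend on the past and may be
randomized. -/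
structure IsExecution (S : LocalSearch Ω 𝓕) {Θ : Type*} [MeasurableSpace Θ] (P : Measure Θ)
    (X : ℕ → Θ → Ω) (F : ℕ → Θ → Option 𝓕) : Prop where
  measurable_state : ∀ t σ, MeasurableSet {θ | X t θ = σ}
  measurable_sel : ∀ t f, MeasurableSet {θ | F t θ = f}
  init : ∀ σ, P {θ | X 0 θ = σ} = S.μ σ
  select : ∀ t, ∀ᵐ θ ∂P, ∀ f, F t θ = some f → X t θ ∈ S.flaw f
  halt : ∀ t, ∀ᵐ θ ∂P, F t θ = none → (∀ f, X t θ ∉ S.flaw f) ∧ X (t + 1) θ = X t θ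
  step : ∀ (t : ℕ) (x : ℕ → Ω) (h : ℕ → Option 𝓕) (g : 𝓕), h t = some g → ∀ σ,
    P {θ | (∀ s ≤ t, X s θ = x s ∧ F s θ = h s) ∧ X (t + 1) θ = σ} =
      P {θ | ∀ s ≤ t, X s θ = x s ∧ F s θ = h s} * S.oracle g (x t) σ

/-- The probability that the event `E` holds at some time of the execution. -/
def everProb {Θ : Type*} [MeasurableSpace Θ] (P : Measure Θ) (X : ℕ → Θ → Ω) (E : Set Ω) :
    ℝ≥0∞ :=
  P {θ | ∃ t, X t θ ∈ E}

/-! ### Witness DAGs -/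

/-- A witness DAG with `n` vertices. -/
structure Wdag (S : LocalSearch Ω 𝓕) (n : ℕ) where
  label : Fin n → 𝓕
  edge : Fin n → Fin n → Prop
  acyclic : ∀ v, ¬ Relation.TransGen edge v v
  edge_iff : ∀ v w, v ≠ w → ((edge v w ∨ edge w v) ↔ S.rel (label v) (label w))

namespace Wdag

variable {S : LocalSearch Ω 𝓕} {n : ℕ}

/-- Source vertices: no incoming edge. -/
def IsSource (H : S.Wdag n) (v : Fin n) : Prop := ∀ u, ¬ H.edge u v

/-- The set of labels of the sink vertices (those without outgoing edge). -/
def sink (H : S.Wdag n) : Set 𝓕 := {f | ∃ v, (∀ u, ¬ H.edge v u) ∧ H.label v = f}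

theorem exists_isSource (H : S.Wdag (n + 1)) : ∃ v, H.IsSource v := by
  have : Std.Irrefl (Relation.TransGen H.edge) := ⟨H.acyclic⟩
  have wf : WellFounded (Relation.TransGen H.edge) :=
    Finite.wellFounded_of_trans_of_irrefl _
  obtain ⟨v, -, hv⟩ := wf.has_min Set.univ ⟨0, trivial⟩
  exact ⟨v, fun u hu => hv u trivial (Relation.TransGen.single hu)⟩

/-- The wdag `H - v`. -/
def delete (H : S.Wdag (n + 1)) (v : Fin (n + 1)) : S.Wdag n where
  label i := H.label (v.succAbove i)
  edge i j := H.edge (v.succAbove i) (v.succAbove j)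
  acyclic i hi := H.acyclic (v.succAbove i) (hi.lift v.succAbove fun _ _ h => h)
  edge_iff _ _ hij := H.edge_iff _ _ fun h => hij (Fin.succAbove_right_injective h)

/-- The matrix `A_H`: the identity for the empty wdag, and `A_{L(v)} A_{H - v}` for an
arbitrarily chosen source `v` otherwise. -/
def mat : {n : ℕ} → S.Wdag n → Ω → Ω → ℝ≥0∞
  | 0, _ => idMat
  | _ + 1, H =>
    mulMat (S.A (H.label H.exists_isSource.choose)) (mat (H.delete H.exists_isSource.choose))

/-- Isomorphism of labelled digraphs. -/
def Iso {m : ℕ} (H : S.Wdag n) (K : S.Wdag m) : Prop :=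
  ∃ e : Fin n ≃ Fin m, (∀ v, K.label (e v) = H.label v) ∧
    ∀ v w, K.edge (e v) (e w) ↔ H.edge v w

end Wdag

/-- Wdags of all finite sizes, with isomorphism as equivalence. -/
def wdagSetoid (S : LocalSearch Ω 𝓕) : Setoid (Σ n, S.Wdag n) where
  r H K := H.2.Iso K.2
  iseqv :=
    { refl := fun _ => ⟨Equiv.refl _, fun _ => rfl, fun _ _ => Iff.rfl⟩
      symm := by
        rintro H K ⟨e, h1, h2⟩
        refine ⟨e.symm, fun v => ?_, fun v w => ?_⟩
        · simpa using (h1 (e.symm v)).symm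
        · simpa using (h2 (e.symm v) (e.symm w)).symm
      trans := by
        rintro H K L ⟨e, h1, h2⟩ ⟨e', h1', h2'⟩
        exact ⟨e.trans e', fun v => (h1' _).trans (h1 v), fun v w => (h2' _ _).trans (h2 v w)⟩ }

/-- Isomorphism classes of wdags. All quantities attached to a class below are those of a
representative; they do not depend on it (for `A_H`, by T-commutativity). -/
def WdagClass (S : LocalSearch Ω 𝓕) : Type _ := Quotient S.wdagSetoid

/-- A representative of an isomorphism class. -/
def WdagClass.rep {S : LocalSearch Ω 𝓕} (H : S.WdagClass) : S.Wdag (Quotient.out H).1 :=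
  (Quotient.out H).2

/-- `𝔚(I)`: all wdags (up to isomorphism) with sink set `I`. -/
def wdags (S : LocalSearch Ω 𝓕) (I : Finset 𝓕) : Set S.WdagClass :=
  {H | H.rep.sink = (I : Set 𝓕)}

/-- `μᵀ A_H e_E`. -/
def matWeight (S : LocalSearch Ω 𝓕) (H : S.WdagClass) (E : Set Ω) : ℝ≥0∞ :=
  ∑' σ, S.μ σ * mulCol H.rep.mat (eVec E) σ

/-! ### Orderable sets -/

/-- `Γ̃(E, σ)`: the flaws that can cause `E` via the state `σ`. -/
def causesAt (S : LocalSearch Ω 𝓕) (E : Set Ω) (σ : Ω) : Set 𝓕 :=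
  {f | ∃ σ', σ' ∉ E ∧ 0 < S.A f σ' σ}

/-- `Γ̃(E)`: the flaws that can cause `E`. -/
def causes (S : LocalSearch Ω 𝓕) (E : Set Ω) : Set 𝓕 := ⋃ σ ∈ E, S.causesAt E σ

/-- `A_{g₁} ⋯ A_{gᵣ} e_E` for the list `[g₁, …, gᵣ]`. -/
def listCol (S : LocalSearch Ω 𝓕) (l : List 𝓕) (E : Set Ω) : Ω → ℝ≥0∞ :=
  l.foldr (fun f v => mulCol (S.A f) v) (eVec E)

/-- `I` is orderable for `E`. -/
def Orderable (S : LocalSearch Ω 𝓕) (E : Set Ω) (I : Finset 𝓕) : Prop :=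
  (I : Set 𝓕) ⊆ S.causes E ∧
    ∃ l : List 𝓕, l.Nodup ∧ (∀ g, g ∈ l ↔ g ∈ I) ∧
      ∀ i < l.length, ¬ (S.listCol (l.drop i) E ≤ S.listCol (l.drop (i + 1)) E)

/-- `𝔍(E)`: the stable sets that are orderable for `E`. -/
def orderables (S : LocalSearch Ω 𝓕) (E : Set Ω) : Set (Finset 𝓕) :=
  {I | S.Stable I ∧ S.Orderable E I}

/-! ### Charges and scalar weights -/

/-- The charge `γ_f = sup_τ ∑_{σ ∈ f} (μ(σ) / μ(τ)) A_f[σ, τ]`. Here `0 / 0 = 0`, whereas a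
transition out of the support of `μ` makes the charge infinite. -/
def charge (S : LocalSearch Ω 𝓕) (f : 𝓕) : ℝ≥0∞ :=
  ⨆ τ, ∑' σ, S.μ σ / S.μ τ * S.A f σ τ

/-- No resampling leads out of the support of `μ`: where the quotient in the charge has
denominator zero, its numerator vanishes. It holds trivially if `μ` is positive everywhere. -/
def SupportClosed (S : LocalSearch Ω 𝓕) : Prop :=
  ∀ f σ τ, S.μ σ ≠ 0 → S.μ τ = 0 → S.A f σ τ = 0

/-- `w(H)`, the product of the charges of the labels. -/
def weight (S : LocalSearch Ω 𝓕) (H : S.WdagClass) : ℝ≥0∞ :=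
  ∏ v, S.charge (H.rep.label v)

/-- `Ψ(I) = ∑_{H ∈ 𝔚(I)} w(H)`. -/
def Psi (S : LocalSearch Ω 𝓕) (I : Finset 𝓕) : ℝ≥0∞ := ∑' H : S.wdags I, S.weight H

/-- `Ψ̄(I) = ∑_{J ⊆ I} Ψ(J)`; infinite `J` would contribute nothing, as wdags are finite. -/
def PsiBar (S : LocalSearch Ω 𝓕) (I : Set 𝓕) : ℝ≥0∞ :=
  ∑' J : {J : Finset 𝓕 // (J : Set 𝓕) ⊆ I}, S.Psi J

/-! ### Local lemma criteria -/

/-- Symmetric criterion. -/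
def SymmetricCrit (S : LocalSearch Ω 𝓕) (p d : ℝ≥0) : Prop :=
  Real.exp 1 * p * d ≤ 1 ∧ ∀ f, S.charge f ≤ p ∧ ((S.nbrIncl f).encard : ℝ≥0∞) ≤ d

/-- Neighborhood bound. -/
def NeighborhoodCrit (S : LocalSearch Ω 𝓕) : Prop :=
  ∀ f, ∑' g : S.nbrIncl f, S.charge g ≤ 1 / 4

/-- Asymmetric criterion. -/
def AsymmetricCrit (S : LocalSearch Ω 𝓕) (x : 𝓕 → ℝ≥0) : Prop :=
  (∀ f, x f < 1) ∧ ∀ f, S.charge f ≤ x f * ∏' g : S.nbr f, (1 - (x g : ℝ≥0∞))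

/-- Cluster-expansion criterion. -/
def ClusterCrit (S : LocalSearch Ω 𝓕) (η : 𝓕 → ℝ≥0) : Prop :=
  ∀ f, S.charge f *
    ∑' I : {I : Finset 𝓕 // (I : Set 𝓕) ⊆ S.nbrIncl f ∧ S.Stable I},
      ∏ g ∈ I.1, (η g : ℝ≥0∞) ≤ η f

end LocalSearch

end

/-! At the first visit to `E`, run through the selected flaws backward in time, starting from the
empty list. Put a flaw `f` in front of the current list `l` if `f` is related to a letter of `l`, or
if `A_f A_l e_E ≤ A_l e_E` fails; otherwise discard it. Joining related letters from left to right
turns the final list into a wdag.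

For a fixed wdag `H`, given the history up to now, the probability that `E` is hit and the
exploration returns `H` is at most the entry of `A_H e_E` at the current state
(`IsExecution.measure_hitList_le`). This is an induction on the time horizon. When `f` is selected,
`H` and `f` decide whether `f` was kept (`explore_cases`). If it was, the later steps must produce
`H` without a source labelled `f`, and `A_f` completes the product. If not, they must produce `H`
itself, and `A_f A_H e_E ≤ A_H e_E`. The bound does not depend on `f`, so the selection rule is
irrelevant. The sinks of an explored wdag, in list order, form an orderable stable set
(`Explored.sinkList_drop`), and a union bound over wdags gives the matrix estimate.

For the scalar bounds, `μᵀ A_f ≤ γ_f μᵀ` gives `μᵀ A_H e_E ≤ w(H) μ(E)`. Removing a sink is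
injective and costs one charge, so cluster expansion yields `Ψ(I) ≤ ∏ η` by induction on the size
(`tsum_weight_size_le`). The other criteria are the special cases `η = e p`, `η = 4 γ` and `η = x /
(1 - x)`. -/

namespace LocalSearch

variable {Ω 𝓕 : Type*} {S : LocalSearch Ω 𝓕}

/-! ### Isomorphism, vertex deletion, sinks, and the wdag of a word -/

namespace Wdag

variable {n m : ℕ}

/-- Sink vertices: no outgoing edge. -/
def IsSink (H : S.Wdag n) (v : Fin n) : Prop := ∀ u, ¬ H.edge v u

theorem not_edge_self (H : S.Wdag n) (v : Fin n) : ¬ H.edge v v :=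
  fun h => H.acyclic v (Relation.TransGen.single h)

theorem Iso.symm {H : S.Wdag n} {K : S.Wdag m} (h : H.Iso K) : K.Iso H :=
  S.wdagSetoid.symm (a := ⟨n, H⟩) (b := ⟨m, K⟩) h

theorem Iso.trans {k : ℕ} {H : S.Wdag n} {K : S.Wdag m} {L : S.Wdag k}
    (h : H.Iso K) (h' : K.Iso L) : H.Iso L :=
  S.wdagSetoid.trans (a := ⟨n, H⟩) (b := ⟨m, K⟩) (c := ⟨k, L⟩) h h'

/-- Deleting corresponding vertices preserves isomorphism. -/
theorem iso_delete {H : S.Wdag (n + 1)} {K : S.Wdag (m + 1)} (e : Fin (n + 1) ≃ Fin (m + 1))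
    (hl : ∀ v, K.label (e v) = H.label v)
    (he : ∀ v w, K.edge (e v) (e w) ↔ H.edge v w) (v : Fin (n + 1)) :
    (H.delete v).Iso (K.delete (e v)) := by
  let d : Fin n ≃ Fin m := (finSuccAboveEquiv v).trans
    ((e.subtypeEquiv (q := fun x => x ≠ e v) fun a => by simp).trans
      (finSuccAboveEquiv (e v)).symm)
  have hd : ∀ i, (e v).succAbove (d i) = e (v.succAbove i) := by
    intro i
    have := congrArg Subtype.val ((finSuccAboveEquiv (e v)).apply_symm_apply
      ((e.subtypeEquiv (q := fun x => x ≠ e v) fun a => by simp) (finSuccAboveEquiv v i)))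
    exact this
  refine ⟨d, fun i => ?_, fun i j => ?_⟩
  · simp only [Wdag.delete, hd, hl]
  · simp only [Wdag.delete, hd, he]

/-- An isomorphism of vertex-deleted wdags extends to the deleted vertices if the adjacencies
with them correspond. -/
theorem iso_of_iso_delete {H : S.Wdag (n + 1)} {K : S.Wdag (m + 1)} {v : Fin (n + 1)}
    {w : Fin (m + 1)} (hl : K.label w = H.label v) (h : (H.delete v).Iso (K.delete w))
    (hin : ∀ i j, K.label (w.succAbove j) = H.label (v.succAbove i) →
      (K.edge (w.succAbove j) w ↔ H.edge (v.succAbove i) v))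
    (hout : ∀ i j, K.label (w.succAbove j) = H.label (v.succAbove i) →
      (K.edge w (w.succAbove j) ↔ H.edge v (v.succAbove i))) : H.Iso K := by
  obtain ⟨e, h1, h2⟩ := h
  let d : Fin (n + 1) ≃ Fin (m + 1) :=
    (finSuccEquiv' v).trans ((Equiv.optionCongr e).trans (finSuccEquiv' w).symm)
  have hv : d v = w := by simp [d]
  have hi : ∀ i, d (v.succAbove i) = w.succAbove (e i) := by intro i; simp [d]
  refine ⟨d, fun a => ?_, fun a b => ?_⟩
  · rcases Fin.eq_self_or_eq_succAbove v a with rfl | ⟨i, rfl⟩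
    · rw [hv, hl]
    · rw [hi]; exact h1 i
  · rcases Fin.eq_self_or_eq_succAbove v a with ha | ⟨i, rfl⟩ <;>
      rcases Fin.eq_self_or_eq_succAbove v b with hb | ⟨j, rfl⟩
    · rw [ha, hb]; simp [hv, not_edge_self]
    · rw [ha, hv, hi]; exact hout j _ (h1 j)
    · rw [hb, hv, hi]; exact hin i _ (h1 i)
    · rw [hi, hi]; exact h2 i j

theorem IsSink.edge_iff_rel {H : S.Wdag n} {v : Fin n} (hv : H.IsSink v) {u : Fin n}
    (hu : u ≠ v) : H.edge u v ↔ S.rel (H.label u) (H.label v) :=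
  ⟨fun h => (H.edge_iff _ _ hu).1 (.inl h),
    fun h => ((H.edge_iff _ _ hu).2 h).resolve_right (hv u)⟩

theorem IsSource.edge_iff_rel {H : S.Wdag n} {v : Fin n} (hv : H.IsSource v) {u : Fin n}
    (hu : u ≠ v) : H.edge v u ↔ S.rel (H.label v) (H.label u) :=
  ⟨fun h => (H.edge_iff _ _ hu.symm).1 (.inl h),
    fun h => ((H.edge_iff _ _ hu.symm).2 h).resolve_right (hv u)⟩

/-- The edges at a sink come from exactly the vertices with related labels, so a wdag is determined
by a sink's label and the rest. This makes the removal of a sink injective on isomorphism classes.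
-/
theorem iso_of_delete_sink {H : S.Wdag (n + 1)} {K : S.Wdag (m + 1)} {v : Fin (n + 1)}
    {w : Fin (m + 1)} (hv : H.IsSink v) (hw : K.IsSink w) (hl : K.label w = H.label v)
    (h : (H.delete v).Iso (K.delete w)) : H.Iso K := by
  refine iso_of_iso_delete hl h (fun i j hij => ?_) (fun i j _ => ?_)
  · rw [hv.edge_iff_rel (Fin.succAbove_ne _ _), hw.edge_iff_rel (Fin.succAbove_ne _ _), hij, hl]
  · exact iff_of_false (hw _) (hv _)

theorem iso_of_delete_source {H : S.Wdag (n + 1)} {K : S.Wdag (m + 1)} {v : Fin (n + 1)}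
    {w : Fin (m + 1)} (hv : H.IsSource v) (hw : K.IsSource w) (hl : K.label w = H.label v)
    (h : (H.delete v).Iso (K.delete w)) : H.Iso K := by
  refine iso_of_iso_delete hl h (fun i j _ => ?_) (fun i j hij => ?_)
  · exact iff_of_false (hw _) (hv _)
  · rw [hv.edge_iff_rel (Fin.succAbove_ne _ _), hw.edge_iff_rel (Fin.succAbove_ne _ _), hij, hl]

theorem Iso.sink_eq {H : S.Wdag n} {K : S.Wdag m} (h : H.Iso K) : H.sink = K.sink := by
  have key : ∀ {n m : ℕ} {H : S.Wdag n} {K : S.Wdag m}, H.Iso K → H.sink ⊆ K.sink := by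
    rintro n m H K ⟨e, h1, h2⟩ f ⟨v, hv, rfl⟩
    refine ⟨e v, fun u hu => hv (e.symm u) ?_, h1 v⟩
    rw [← h2]; simpa using hu
  exact (key h).antisymm (key h.symm)

theorem Iso.size_eq {H : S.Wdag n} {K : S.Wdag m} (h : H.Iso K) : n = m := by
  obtain ⟨e, -⟩ := h
  simpa using Fintype.card_congr e

theorem Iso.prod_eq {M : Type*} [CommMonoid M] {H : S.Wdag n} {K : S.Wdag m} (h : H.Iso K)
    (γ : 𝓕 → M) : ∏ v, γ (H.label v) = ∏ v, γ (K.label v) := by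
  obtain ⟨e, h1, -⟩ := h
  exact Fintype.prod_equiv e _ _ fun v => by rw [h1]

theorem sink_stable (H : S.Wdag n) {f g : 𝓕} (hf : f ∈ H.sink) (hg : g ∈ H.sink) (hfg : f ≠ g) :
    ¬ S.rel f g := by
  obtain ⟨v, hv, rfl⟩ := hf
  obtain ⟨w, hw, rfl⟩ := hg
  intro h
  have hvw : v ≠ w := fun h => hfg (by rw [h])
  rcases (H.edge_iff v w hvw).2 h with h | h
  · exact hv _ h
  · exact hw _ h

theorem sink_finite (H : S.Wdag n) : H.sink.Finite :=
  (Set.finite_range H.label).subset (by rintro f ⟨v, -, rfl⟩; exact ⟨v, rfl⟩)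

theorem exists_isSink (H : S.Wdag (n + 1)) : ∃ v, H.IsSink v := by
  have : Std.Irrefl (Function.swap (Relation.TransGen H.edge)) := ⟨H.acyclic⟩
  have : IsTrans (Fin (n + 1)) (Function.swap (Relation.TransGen H.edge)) :=
    ⟨fun _ _ _ h1 h2 => Relation.TransGen.trans h2 h1⟩
  have wf : WellFounded (Function.swap (Relation.TransGen H.edge)) :=
    Finite.wellFounded_of_trans_of_irrefl _
  obtain ⟨v, -, hv⟩ := wf.has_min Set.univ ⟨0, trivial⟩
  exact ⟨v, fun u hu => hv u trivial (Relation.TransGen.single hu)⟩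

/-- The sinks of `H - v`, for a sink `v`, are the other sinks of `H` and some neighbors of `v`. -/
theorem sink_delete_subset (H : S.Wdag (n + 1)) {v : Fin (n + 1)} :
    (H.delete v).sink ⊆ (H.sink \ {H.label v}) ∪ S.nbrIncl (H.label v) := by
  rintro f ⟨i, hi, rfl⟩
  by_cases hr : S.rel (H.label v) (H.label (v.succAbove i))
  · exact .inr hr
  · refine .inl ⟨⟨v.succAbove i, fun u hu => ?_, rfl⟩, fun h => ?_⟩
    · rcases Fin.eq_self_or_eq_succAbove v u with rfl | ⟨j, rfl⟩
      · exact hr (S.rel_symm _ _ ((H.edge_iff _ _ (Fin.succAbove_ne _ _)).1 (.inl hu)))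
      · exact hi j hu
    · have h' : H.label (v.succAbove i) = H.label v := h
      exact hr (by rw [h']; exact S.rel_refl _)

theorem subset_sink_delete (H : S.Wdag (n + 1)) {v : Fin (n + 1)} :
    H.sink \ {H.label v} ⊆ (H.delete v).sink := by
  rintro f ⟨⟨u, hu, rfl⟩, hf⟩
  rcases Fin.eq_self_or_eq_succAbove v u with rfl | ⟨j, rfl⟩
  · exact absurd rfl hf
  · exact ⟨j, fun k hk => hu _ hk, rfl⟩

/-- The wdag of a word: letters that are related are joined by an edge, from left to right. -/
def ofWord (S : LocalSearch Ω 𝓕) (u : Fin n → 𝓕) : S.Wdag n where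
  label := u
  edge i j := i < j ∧ S.rel (u i) (u j)
  acyclic v hv := by
    have key : ∀ i j, Relation.TransGen (fun i j => i < j ∧ S.rel (u i) (u j)) i j → i < j := by
      intro i j h
      induction h with
      | single h => exact h.1
      | tail _ h ih => exact ih.trans h.1
    exact lt_irrefl v (key v v hv)
  edge_iff v w hvw := by
    refine ⟨?_, fun h => ?_⟩
    · rintro (h | h)
      · exact h.2
      · exact S.rel_symm _ _ h.2
    · rcases lt_or_gt_of_ne hvw with h' | h'
      · exact .inl ⟨h', h⟩
      · exact .inr ⟨h', S.rel_symm _ _ h⟩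

theorem delete_ofWord (u : Fin (n + 1) → 𝓕) (w : Fin (n + 1)) :
    (ofWord S u).delete w = ofWord S (fun i => u (w.succAbove i)) := by
  simp [ofWord, Wdag.delete]

theorem ofWord_isSource_zero (u : Fin (n + 1) → 𝓕) : (ofWord S u).IsSource 0 :=
  fun i hi => absurd hi.1 (Fin.not_lt_zero i)

/-- If a word starting with `f` and the word `u` have isomorphic wdags, then `f` can be moved to
the front in `u`. -/
theorem exists_of_iso_ofWord {u : Fin (n + 1) → 𝓕} {u' : Fin m → 𝓕}
    (h : (ofWord S u).Iso (ofWord S u')) :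
    ∃ (k : ℕ) (hk : k + 1 = m) (w : Fin (k + 1)), u' (w.cast hk) = u 0 ∧
      (∀ i < w, ¬ S.rel (u 0) (u' (i.cast hk))) ∧
      (ofWord S (fun i => u (Fin.succ i))).Iso
        (ofWord S (fun i => u' ((w.succAbove i).cast hk))) := by
  obtain rfl : n + 1 = m := h.size_eq
  obtain ⟨e, h1, h2⟩ := h
  refine ⟨n, rfl, e 0, h1 0, fun i hi hr => ?_, ?_⟩
  -- A related letter before the image of vertex `0` would send an edge into it, but vertex `0` is a
  -- source.
  · have h3 : (ofWord S u').edge i (e 0) := ⟨hi, by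
      have : u' (e 0) = u 0 := h1 0
      rw [this]; exact S.rel_symm _ _ hr⟩
    rw [← e.apply_symm_apply i, h2] at h3
    exact ofWord_isSource_zero u _ h3
  · have := iso_delete e h1 h2 0
    rw [delete_ofWord, delete_ofWord] at this
    exact this

theorem mem_sink_ofWord_cons (f g : 𝓕) (l : List 𝓕) :
    g ∈ (ofWord S (f :: l).get).sink ↔
      (g = f ∧ ∀ b ∈ l, ¬ S.rel f b) ∨ g ∈ (ofWord S l.get).sink := by
  constructor
  · rintro ⟨v, hv, rfl⟩
    refine Fin.cases (motive := fun v => (∀ u, ¬ (ofWord S (f :: l).get).edge v u) →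
      ((ofWord S (f :: l).get).label v = f ∧ ∀ b ∈ l, ¬ S.rel f b) ∨
        (ofWord S (f :: l).get).label v ∈ (ofWord S l.get).sink) (fun hv => ?_) (fun i hv => ?_) v hv
    · refine .inl ⟨rfl, fun b hb hr => ?_⟩
      obtain ⟨j, rfl⟩ := List.get_of_mem hb
      exact hv j.succ ⟨Fin.succ_pos _, hr⟩
    · exact .inr ⟨i, fun j hj => hv j.succ ⟨Fin.succ_lt_succ_iff.2 hj.1, hj.2⟩, rfl⟩
  · rintro (⟨rfl, h⟩ | ⟨i, hi, rfl⟩)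
    · refine ⟨(0 : Fin (l.length + 1)), fun u hu => ?_, rfl⟩
      refine Fin.cases (motive := fun u => ¬ (ofWord S (g :: l).get).edge (0 : Fin (l.length + 1)) u)
        (fun hu => lt_irrefl _ hu.1) (fun j hj => ?_) u hu
      exact h _ (List.get_mem l j) hj.2
    · refine ⟨i.succ, fun u hu => ?_, rfl⟩
      refine Fin.cases (motive := fun u => ¬ (ofWord S (f :: l).get).edge i.succ u)
        (fun hu => Fin.not_lt_zero _ hu.1) (fun j hj => ?_) u hu
      exact hi j ⟨Fin.succ_lt_succ_iff.1 hj.1, hj.2⟩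

end Wdag

/-! ### Wdags as words up to commutation of unrelated letters -/

/-- The isomorphism class of the wdag of a list of flaws. -/
def cls (S : LocalSearch Ω 𝓕) (l : List 𝓕) : S.WdagClass :=
  Quotient.mk S.wdagSetoid ⟨l.length, Wdag.ofWord S l.get⟩

theorem rep_iso_of_eq {n : ℕ} {H : S.WdagClass} {K : S.Wdag n}
    (h : H = Quotient.mk S.wdagSetoid ⟨n, K⟩) : H.rep.Iso K := by
  have := Quotient.mk_out (s := S.wdagSetoid) (⟨n, K⟩ : Σ n, S.Wdag n)
  rw [← h] at this
  exact this

theorem eq_of_rep_iso {H K : S.WdagClass} (h : H.rep.Iso K.rep) : H = K := by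
  rw [← Quotient.out_eq H, ← Quotient.out_eq K]
  exact Quotient.sound h

theorem cls_eq_iff {l l' : List 𝓕} :
    S.cls l = S.cls l' ↔ (Wdag.ofWord S l.get).Iso (Wdag.ofWord S l'.get) :=
  Quotient.eq (r := S.wdagSetoid)

theorem ofWord_iso_get {n : ℕ} {u : Fin n → 𝓕} {l : List 𝓕} (h : l = List.ofFn u) :
    (Wdag.ofWord S u).Iso (Wdag.ofWord S l.get) := by
  subst h
  exact ⟨finCongr (List.length_ofFn).symm, fun v => by simp [Wdag.ofWord],
    fun v w => by simp [Wdag.ofWord]⟩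

/-- Letters of a word that can be moved to the front. -/
theorem exists_of_cls_cons_eq {f : 𝓕} {l l' : List 𝓕} (h : S.cls (f :: l) = S.cls l') :
    ∃ a b, l' = a ++ f :: b ∧ (∀ g ∈ a, ¬ S.rel f g) ∧ S.cls l = S.cls (a ++ b) := by
  rw [cls_eq_iff] at h
  obtain ⟨k, hk, w, h1, h2, h3⟩ := Wdag.exists_of_iso_ofWord (n := l.length) h
  have hw : w.val < l'.length := hk ▸ w.2
  refine ⟨l'.take w, l'.drop (w + 1), ?_, ?_, ?_⟩
  · have h4 : l'[w.val] = f := h1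
    conv_lhs => rw [← List.take_append_drop w.val l', List.drop_eq_getElem_cons hw, h4]
  · intro g hg
    obtain ⟨i, hi, rfl⟩ := List.getElem_of_mem hg
    rw [List.length_take] at hi
    rw [List.getElem_take]
    exact h2 ⟨i, by omega⟩ (by rw [Fin.lt_def]; simp only []; omega)
  · rw [cls_eq_iff]
    refine Wdag.Iso.trans h3 (ofWord_iso_get ?_)
    rw [← List.eraseIdx_eq_take_drop_succ]
    refine List.ext_getElem ?_ fun i hi hi' => ?_
    · rw [List.length_eraseIdx_of_lt hw, List.length_ofFn]; omega
    · rw [List.getElem_eraseIdx, List.getElem_ofFn]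
      simp only [Fin.succAbove, Fin.lt_def, List.get_eq_getElem, Fin.val_cast, Fin.castSucc_mk]
      split_ifs <;> simp

/-- Words with the same wdag have the same letters. -/
theorem perm_of_cls_eq {l l' : List 𝓕} (h : S.cls l = S.cls l') : l.Perm l' := by
  induction l generalizing l' with
  | nil =>
    have := (cls_eq_iff.1 h).size_eq
    rw [List.length_nil, eq_comm, List.length_eq_zero_iff] at this
    rw [this]
  | cons f l ih =>
    obtain ⟨a, b, rfl, -, h'⟩ := exists_of_cls_cons_eq h
    exact ((ih h').cons f).trans List.perm_middle.symm

/-- The letters that the leading `f` of the first word has to jump over in `f :: l'` are unrelated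
to `f`. There are none, since the first of them would be `f` itself. -/
theorem cls_cons_cancel {f : 𝓕} {l l' : List 𝓕} (h : S.cls (f :: l) = S.cls (f :: l')) :
    S.cls l = S.cls l' := by
  obtain ⟨a, b, h1, h2, h3⟩ := exists_of_cls_cons_eq h
  cases a with
  | nil => simp only [List.nil_append, List.cons.injEq, true_and] at h1; subst h1; exact h3
  | cons g a =>
    simp only [List.cons_append, List.cons.injEq] at h1
    exact absurd (h1.1 ▸ S.rel_refl f) (h2 g (by simp))

/-- The product of the transition matrices along a list. -/
noncomputable def listMat (S : LocalSearch Ω 𝓕) (l : List 𝓕) : Ω → Ω → ℝ≥0∞ :=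
  l.foldr (fun f M => mulMat (S.A f) M) idMat

/-- Every wdag comes from a word along which its matrix is computed. -/
theorem Wdag.exists_list {n : ℕ} (H : S.Wdag n) :
    ∃ l : List 𝓕, H.Iso (ofWord S l.get) ∧ H.mat = S.listMat l := by
  induction n with
  | zero =>
    refine ⟨[], ⟨Equiv.refl _, fun v => v.elim0, fun v => v.elim0⟩, rfl⟩
  | succ n ih =>
    -- The word lists the very sources that `Wdag.mat` chooses, so the matrices agree without any
    -- commutativity.
    obtain ⟨l, h1, h2⟩ := ih (H.delete H.exists_isSource.choose)
    refine ⟨H.label H.exists_isSource.choose :: l, ?_, ?_⟩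
    · refine iso_of_delete_source (m := l.length) H.exists_isSource.choose_spec
        (ofWord_isSource_zero (n := l.length) _) rfl ?_
      rw [delete_ofWord]
      exact h1
    · rw [Wdag.mat, h2]; rfl

theorem WdagClass.exists_list (H : S.WdagClass) :
    ∃ l : List 𝓕, H = S.cls l ∧ H.rep.mat = S.listMat l := by
  obtain ⟨l, h1, h2⟩ := Wdag.exists_list H.rep
  refine ⟨l, ?_, h2⟩
  rw [← Quotient.out_eq H]
  exact Quotient.sound h1

/-! ### Matrices along lists of flaws, and backward exploration -/

theorem mulCol_mulMat (M N : Ω → Ω → ℝ≥0∞) (v : Ω → ℝ≥0∞) :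
    mulCol (mulMat M N) v = mulCol M (mulCol N v) := by
  funext σ
  simp only [mulCol, mulMat, ← ENNReal.tsum_mul_right, ← ENNReal.tsum_mul_left]
  rw [ENNReal.tsum_comm]
  simp only [mul_assoc]

theorem mulCol_idMat (v : Ω → ℝ≥0∞) : mulCol idMat v = v := by
  funext σ
  rw [mulCol, tsum_eq_single σ]
  · simp [idMat]
  · intro τ hτ; simp [idMat, hτ]

theorem mulCol_mono (M : Ω → Ω → ℝ≥0∞) {v w : Ω → ℝ≥0∞} (h : v ≤ w) :
    mulCol M v ≤ mulCol M w :=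
  fun _ => ENNReal.tsum_le_tsum fun τ => mul_le_mul_right (h τ) _

/-- Apply the transition matrices of a list of flaws to a column vector. -/
noncomputable def applyList (S : LocalSearch Ω 𝓕) (l : List 𝓕) (v : Ω → ℝ≥0∞) : Ω → ℝ≥0∞ :=
  l.foldr (fun f v => mulCol (S.A f) v) v

theorem applyList_append (l l' : List 𝓕) (v : Ω → ℝ≥0∞) :
    S.applyList (l ++ l') v = S.applyList l (S.applyList l' v) := by
  simp [applyList]

theorem applyList_cons (f : 𝓕) (l : List 𝓕) (v : Ω → ℝ≥0∞) :
    S.applyList (f :: l) v = mulCol (S.A f) (S.applyList l v) := rfl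

theorem listCol_eq (l : List 𝓕) (E : Set Ω) : S.listCol l E = S.applyList l (eVec E) := rfl

theorem listCol_cons (f : 𝓕) (l : List 𝓕) (E : Set Ω) :
    S.listCol (f :: l) E = mulCol (S.A f) (S.listCol l E) := rfl

theorem applyList_mono (l : List 𝓕) {v w : Ω → ℝ≥0∞} (h : v ≤ w) :
    S.applyList l v ≤ S.applyList l w := by
  induction l with
  | nil => exact h
  | cons f l ih => exact mulCol_mono _ ih

theorem mulCol_listMat (l : List 𝓕) (v : Ω → ℝ≥0∞) :
    mulCol (S.listMat l) v = S.applyList l v := by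
  induction l with
  | nil => exact mulCol_idMat v
  | cons f l ih =>
    rw [applyList_cons, ← ih, ← mulCol_mulMat]; rfl

theorem mulCol_applyList_comm (hT : S.TCommutative) {f : 𝓕} {l : List 𝓕}
    (h : ∀ g ∈ l, ¬ S.rel f g) (v : Ω → ℝ≥0∞) :
    mulCol (S.A f) (S.applyList l v) = S.applyList l (mulCol (S.A f) v) := by
  induction l with
  | nil => rfl
  | cons g l ih =>
    rw [applyList_cons, applyList_cons, ← ih fun g hg => h g (List.mem_cons_of_mem _ hg),
      ← mulCol_mulMat, ← mulCol_mulMat, hT f g (h g (by simp))]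

/-- The first letter of `l` occurs in `l'` behind letters unrelated to it, and its matrix commutes
past theirs. This is the independence of `A_H` from the chosen sources. -/
theorem applyList_eq_of_cls_eq (hT : S.TCommutative) {l l' : List 𝓕} (h : S.cls l = S.cls l')
    (v : Ω → ℝ≥0∞) : S.applyList l v = S.applyList l' v := by
  induction l generalizing l' with
  | nil => rw [(perm_of_cls_eq h).nil_eq]
  | cons f l ih =>
    obtain ⟨a, b, rfl, h1, h2⟩ := exists_of_cls_cons_eq h
    rw [applyList_cons, ih h2, applyList_append, applyList_append, applyList_cons,
      mulCol_applyList_comm hT h1]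

theorem mulCol_rep_cls (hT : S.TCommutative) (l : List 𝓕) (v : Ω → ℝ≥0∞) :
    mulCol (S.cls l).rep.mat v = S.applyList l v := by
  obtain ⟨l', h1, h2⟩ := (S.cls l).exists_list
  rw [h2, mulCol_listMat, applyList_eq_of_cls_eq hT h1]

theorem tsum_A_le_one (f : 𝓕) (σ : Ω) : ∑' τ, S.A f σ τ ≤ 1 := by
  by_cases h : σ ∈ S.flaw f
  · simp [A, h, PMF.tsum_coe]
  · simp [A, h]

/-- A flaw that does not cause `E` cannot increase the probability of `E`. -/
theorem mulCol_eVec_le {f : 𝓕} {E : Set Ω} (hf : f ∉ S.causes E) :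
    mulCol (S.A f) (eVec E) ≤ eVec E := by
  intro σ
  by_cases hσ : σ ∈ E
  · calc mulCol (S.A f) (eVec E) σ ≤ ∑' τ, S.A f σ τ := by
          refine ENNReal.tsum_le_tsum fun τ => mul_le_of_le_one_right' ?_
          exact Set.indicator_le_self' (by simp) τ
      _ ≤ 1 := tsum_A_le_one f σ
      _ = eVec E σ := by simp [eVec, hσ]
  · refine le_of_eq_of_le ?_ zero_le
    refine ENNReal.tsum_eq_zero.2 fun τ => ?_
    by_cases hτ : τ ∈ E
    · have : S.A f σ τ = 0 := by
        by_contra h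
        exact hf (Set.mem_biUnion hτ ⟨σ, hσ, pos_iff_ne_zero.2 h⟩)
      simp [this]
    · simp [eVec, hτ]

open Classical in
/-- The sinks of the wdag of a list. -/
noncomputable def sinkList (S : LocalSearch Ω 𝓕) : List 𝓕 → List 𝓕
  | [] => []
  | f :: l => if ∃ g ∈ l, S.rel f g then sinkList S l else f :: sinkList S l

open Classical in
/-- The letters of a list that are not sinks of its wdag. -/
noncomputable def nonsinkList (S : LocalSearch Ω 𝓕) : List 𝓕 → List 𝓕
  | [] => []
  | f :: l => if ∃ g ∈ l, S.rel f g then f :: nonsinkList S l else nonsinkList S l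

theorem mem_of_mem_sinkList {l : List 𝓕} {f : 𝓕} (h : f ∈ S.sinkList l) : f ∈ l := by
  induction l with
  | nil => exact h
  | cons g l ih =>
    rw [sinkList] at h
    split_ifs at h <;> grind

theorem mem_of_mem_nonsinkList {l : List 𝓕} {f : 𝓕} (h : f ∈ S.nonsinkList l) : f ∈ l := by
  induction l with
  | nil => exact h
  | cons g l ih =>
    rw [nonsinkList] at h
    split_ifs at h <;> grind

/-- A sink is unrelated to all later letters, so its matrix moves to the right past the later
nonsinks. -/
theorem applyList_sinkList (hT : S.TCommutative) (l : List 𝓕) (v : Ω → ℝ≥0∞) :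
    S.applyList l v = S.applyList (S.nonsinkList l) (S.applyList (S.sinkList l) v) := by
  induction l with
  | nil => rfl
  | cons f l ih =>
    rw [sinkList, nonsinkList]
    split_ifs with h
    · rw [applyList_cons, ih, applyList_cons]
    · push Not at h
      rw [applyList_cons, ih, mulCol_applyList_comm hT fun g hg => h g (mem_of_mem_nonsinkList hg),
        applyList_cons]

theorem mem_sink_ofWord_iff (l : List 𝓕) (f : 𝓕) :
    f ∈ (Wdag.ofWord S l.get).sink ↔ f ∈ S.sinkList l := by
  induction l with
  | nil => exact iff_of_false (fun ⟨v, _⟩ => v.elim0) (by simp [sinkList])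
  | cons g l ih =>
    rw [Wdag.mem_sink_ofWord_cons, ih, sinkList]
    split_ifs with h
    · have : ¬ ∀ b ∈ l, ¬ S.rel g b := by push Not; exact h
      simp [this]
    · push Not at h
      simp only [List.mem_cons]
      tauto

theorem sink_rep_cls (l : List 𝓕) : (S.cls l).rep.sink = {f | f ∈ S.sinkList l} := by
  rw [(rep_iso_of_eq (rfl : S.cls l = _)).sink_eq]
  ext f
  exact mem_sink_ofWord_iff l f

/-- Backward exploration keeps a flaw `f` in front of `l` if it is related to a flaw in `l` or if
it may increase the weight of `l`. -/
def Keeps (S : LocalSearch Ω 𝓕) (E : Set Ω) (f : 𝓕) (l : List 𝓕) : Prop :=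
  (∃ g ∈ l, S.rel f g) ∨ ¬ mulCol (S.A f) (S.listCol l E) ≤ S.listCol l E

/-- Lists that backward exploration can produce. -/
inductive Explored (S : LocalSearch Ω 𝓕) (E : Set Ω) : List 𝓕 → Prop
  | nil : Explored S E []
  | cons {f : 𝓕} {l : List 𝓕} : Explored S E l → S.Keeps E f l → Explored S E (f :: l)

/-- A newly kept sink is unrelated to `l`, so it was kept because it increases an entry of the
column of `l`. That column is the nonsinks of `l` applied to the column of its sinks. Commuting past
the nonsinks and using monotonicity, the new sink must already increase the column of the sinks,
which is the condition in `Orderable`. -/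
theorem Explored.sinkList_drop (hT : S.TCommutative) {E : Set Ω} {l : List 𝓕}
    (h : S.Explored E l) :
    (S.sinkList l).Nodup ∧ (∀ f ∈ S.sinkList l, f ∈ S.causes E) ∧
      ∀ i < (S.sinkList l).length, ¬ (S.listCol ((S.sinkList l).drop i) E ≤
        S.listCol ((S.sinkList l).drop (i + 1)) E) := by
  induction h with
  | nil => simp [sinkList]
  | @cons f l _ hk ih =>
    obtain ⟨ih1, ih2, ih3⟩ := ih
    rw [sinkList]
    split_ifs with h
    · exact ⟨ih1, ih2, ih3⟩
    · have hk := hk.resolve_left h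
      push Not at h
      have hs : ¬ S.listCol (f :: S.sinkList l) E ≤ S.listCol (S.sinkList l) E := by
        contrapose! hk
        rw [listCol_eq l, applyList_sinkList hT,
          mulCol_applyList_comm hT fun g hg => h g (mem_of_mem_nonsinkList hg)]
        exact applyList_mono _ hk
      refine ⟨List.nodup_cons.2 ⟨fun hf => h f (mem_of_mem_sinkList hf) (S.rel_refl f), ih1⟩,
        fun g hg => ?_, fun i hi => ?_⟩
      · rcases List.mem_cons.1 hg with rfl | hg
        -- If `g` could not cause `E`, it would not increase `e_E`. As it commutes past the later
        -- sinks, it would not increase their column either.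
        · by_contra hc
          refine hs ?_
          rw [listCol_cons, listCol_eq,
            mulCol_applyList_comm hT fun g hg => h g (mem_of_mem_sinkList hg)]
          exact applyList_mono _ (mulCol_eVec_le hc)
        · exact ih2 g hg
      · cases i with
        | zero => exact hs
        | succ i => exact ih3 i (by simpa using hi)

open Classical in
/-- The sinks of an explored wdag form an orderable stable set. -/
theorem Explored.exists_orderable (hT : S.TCommutative) {E : Set Ω} {l : List 𝓕}
    (h : S.Explored E l) : ∃ I ∈ S.orderables E, S.cls l ∈ S.wdags I := by
  obtain ⟨h1, h2, h3⟩ := h.sinkList_drop hT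
  have hs : (S.cls l).rep.sink = (((S.sinkList l).toFinset : Finset 𝓕) : Set 𝓕) := by
    rw [sink_rep_cls]; ext f; simp
  refine ⟨(S.sinkList l).toFinset, ⟨fun f hf g hg hfg => ?_, fun f hf => ?_, S.sinkList l, h1,
    by simp, h3⟩, hs⟩
  · refine (S.cls l).rep.sink_stable ?_ ?_ hfg <;> rw [hs] <;> assumption
  · exact h2 f (by simpa using hf)

end LocalSearch

/-! ### Executions and the distribution of the explored wdag -/

namespace LocalSearch

variable {Ω 𝓕 : Type*} {S : LocalSearch Ω 𝓕} {Θ : Type*} {E : Set Ω} {X : ℕ → Θ → Ω}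
  {F : ℕ → Θ → Option 𝓕}

open Classical in
/-- Put `f` in front of `l` if backward exploration keeps it. -/
noncomputable def explore (S : LocalSearch Ω 𝓕) (E : Set Ω) (f : 𝓕) (l : List 𝓕) : List 𝓕 :=
  if S.Keeps E f l then f :: l else l

open Classical in
/-- If `E` is hit in the time interval `[s, s + k]`, the list of flaws that backward exploration
from the first hitting time down to time `s` produces. -/
noncomputable def hitList (S : LocalSearch Ω 𝓕) (E : Set Ω) (X : ℕ → Θ → Ω)
    (F : ℕ → Θ → Option 𝓕) : ℕ → ℕ → Θ → Option (List 𝓕)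
  | 0, s, θ => if X s θ ∈ E then some [] else none
  | k + 1, s, θ => if X s θ ∈ E then some [] else
      (F s θ).bind fun f => (hitList S E X F k (s + 1) θ).map (S.explore E f)

theorem hitList_of_mem {k s : ℕ} {θ : Θ} (h : X s θ ∈ E) : S.hitList E X F k s θ = some [] := by
  cases k <;> simp [hitList, h]

theorem hitList_zero_of_notMem {s : ℕ} {θ : Θ} (h : X s θ ∉ E) :
    S.hitList E X F 0 s θ = none := by
  simp [hitList, h]

theorem hitList_succ_of_notMem {k s : ℕ} {θ : Θ} (h : X s θ ∉ E) :
    S.hitList E X F (k + 1) s θ =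
      (F s θ).bind fun f => (S.hitList E X F k (s + 1) θ).map (S.explore E f) := by
  simp [hitList, h]

theorem explored_of_hitList {k s : ℕ} {θ : Θ} {l : List 𝓕}
    (h : S.hitList E X F k s θ = some l) : S.Explored E l := by
  induction k generalizing s l with
  | zero =>
    by_cases hE : X s θ ∈ E
    · rw [hitList_of_mem hE, Option.some_inj] at h
      exact h ▸ .nil
    · rw [hitList_zero_of_notMem hE] at h; cases h
  | succ k ih =>
    by_cases hE : X s θ ∈ E
    · rw [hitList_of_mem hE, Option.some_inj] at h
      exact h ▸ .nil
    · rw [hitList_succ_of_notMem hE, Option.bind_eq_some_iff] at h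
      obtain ⟨f, -, h⟩ := h
      obtain ⟨l', hl', rfl⟩ := Option.map_eq_some_iff.1 h
      rw [explore]
      split_ifs with hk
      · exact (ih hl').cons hk
      · exact ih hl'

/-- The detection events grow with the horizon `k`, so continuity from below reduces the theorem to
finite horizons. -/
theorem hitList_ne_none_succ {k s : ℕ} {θ : Θ} (h : S.hitList E X F k s θ ≠ none) :
    S.hitList E X F (k + 1) s θ ≠ none := by
  induction k generalizing s with
  | zero =>
    by_cases hE : X s θ ∈ E
    · simp [hitList_of_mem hE]
    · exact absurd (hitList_zero_of_notMem hE) h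
  | succ k ih =>
    by_cases hE : X s θ ∈ E
    · simp [hitList_of_mem hE]
    · rw [hitList_succ_of_notMem hE] at h ⊢
      cases hF : F s θ with
      | none => simp [hF] at h
      | some f =>
        simp only [hF, Option.bind_some, ne_eq, Option.map_eq_none_iff] at h ⊢
        exact ih h

/-- Along a regular trajectory, a visit to `E` is detected. -/
theorem hitList_ne_none {θ : Θ} (hsel : ∀ t f, F t θ = some f → X t θ ∈ S.flaw f)
    (hhalt : ∀ t, F t θ = none → (∀ f, X t θ ∉ S.flaw f) ∧ X (t + 1) θ = X t θ) {k s : ℕ}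
    (h : X (s + k) θ ∈ E) : S.hitList E X F k s θ ≠ none := by
  induction k generalizing s with
  | zero => simp [hitList_of_mem (S := S) (F := F) (k := 0) (s := s) h]
  | succ k ih =>
    by_cases hE : X s θ ∈ E
    · simp [hitList_of_mem hE]
    · rw [hitList_succ_of_notMem hE]
      cases hF : F s θ with
      | none =>
        -- A stopped execution stays put: no flaw holds on its state, so none can be selected later.
        -- Hence `E` cannot be reached after stopping outside it.
        have hconst : ∀ j, F (s + j) θ = none ∧ X (s + j) θ = X s θ := by
          intro j
          induction j with
          | zero => exact ⟨hF, rfl⟩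
          | succ j ihj =>
            obtain ⟨h1, h2⟩ := hhalt _ ihj.1
            rw [add_assoc] at h2
            refine ⟨?_, h2.trans ihj.2⟩
            cases hg : F (s + (j + 1)) θ with
            | none => rfl
            | some g => exact absurd (h2 ▸ hsel _ _ hg) (h1 g)
        exact absurd ((hconst _).2 ▸ h) hE
      | some f =>
        simp only [Option.bind_some, ne_eq, Option.map_eq_none_iff]
        exact ih (by rwa [add_right_comm, add_assoc])

/-- The trajectories with a given history of states up to time `s` and of selected flaws before
time `s`. -/
def history (X : ℕ → Θ → Ω) (F : ℕ → Θ → Option 𝓕) (x : ℕ → Ω) (h : ℕ → Option 𝓕) (s : ℕ) :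
    Set Θ :=
  {θ | (∀ r < s, X r θ = x r ∧ F r θ = h r) ∧ X s θ = x s}

theorem history_succ (x : ℕ → Ω) (h : ℕ → Option 𝓕) (s : ℕ) (f : 𝓕) (τ : Ω) :
    history X F x h s ∩ {θ | F s θ = some f} ∩ {θ | X (s + 1) θ = τ} =
      history X F (Function.update x (s + 1) τ) (Function.update h s (some f)) (s + 1) := by
  ext θ
  constructor
  · rintro ⟨⟨⟨h1, h2⟩, h3⟩, h4⟩
    refine ⟨fun r hr => ?_, by simpa using h4⟩
    rw [Function.update_of_ne hr.ne]
    rcases (Nat.lt_succ_iff.1 hr).lt_or_eq with hr | rfl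
    · simpa [hr.ne] using h1 r hr
    · simpa using ⟨h2, h3⟩
  · rintro ⟨h1, h2⟩
    have h3 := h1 s (Nat.lt_succ_self s)
    rw [Function.update_of_ne (by omega), Function.update_self] at h3
    refine ⟨⟨⟨fun r hr => ?_, h3.1⟩, h3.2⟩, by simpa using h2⟩
    have := h1 r (hr.trans (Nat.lt_succ_self s))
    rwa [Function.update_of_ne (by omega), Function.update_of_ne hr.ne] at this

/-- If some word for the target class starts with `f`, then `f` was kept: otherwise `f` would
already be a letter of `l`, and being related to itself it would be kept. The rest is then unique by
cancellation. If no such word exists, `f` was discarded and `l` has the target class. In that case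
the inequality comes from the discarding itself, so it is available only once some `l` occurs. -/
theorem explore_cases (hT : S.TCommutative) (f : 𝓕) (l₀ : List 𝓕) :
    ∃ l₁, (∀ l, S.cls (S.explore E f l) = S.cls l₀ →
      S.cls l = S.cls l₁ ∧ S.listCol (f :: l₁) E ≤ S.listCol l₀ E) := by
  by_cases h : ∃ l₁, S.cls (f :: l₁) = S.cls l₀
  · obtain ⟨l₁, hl₁⟩ := h
    refine ⟨l₁, fun l hl => ⟨?_, (applyList_eq_of_cls_eq hT hl₁ _).le⟩⟩
    rw [explore] at hl
    split_ifs at hl with hk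
    · exact cls_cons_cancel (hl.trans hl₁.symm)
    · refine absurd (.inl ⟨f, ?_, S.rel_refl f⟩) hk
      exact (perm_of_cls_eq (hl₁.trans hl.symm)).subset (by simp)
  · refine ⟨l₀, fun l hl => ?_⟩
    rw [explore] at hl
    split_ifs at hl with hk
    · exact absurd ⟨l, hl⟩ h
    · refine ⟨hl, ?_⟩
      rw [Keeps, not_or, not_not] at hk
      have : S.listCol l E = S.listCol l₀ E := applyList_eq_of_cls_eq hT hl _
      rw [listCol_cons, ← this]
      exact hk.2

variable [MeasurableSpace Θ] {P : Measure Θ}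

theorem IsExecution.measurableSet_history (hX : S.IsExecution P X F) (x : ℕ → Ω)
    (h : ℕ → Option 𝓕) (s : ℕ) : MeasurableSet (history X F x h s) := by
  have : history X F x h s = (⋂ r, ⋂ (_ : r < s), {θ | X r θ = x r} ∩ {θ | F r θ = h r}) ∩
      {θ | X s θ = x s} := by
    ext θ; simp [history]
  rw [this]
  exact (MeasurableSet.iInter fun r => MeasurableSet.iInter fun _ =>
    (hX.measurable_state r _).inter (hX.measurable_sel r _)).inter (hX.measurable_state s _)

theorem IsExecution.measure_step (hX : S.IsExecution P X F) (x : ℕ → Ω)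
    (h : ℕ → Option 𝓕) (s : ℕ) (f : 𝓕) (τ : Ω) :
    P (history X F x h s ∩ {θ | F s θ = some f} ∩ {θ | X (s + 1) θ = τ}) =
      P (history X F x h s ∩ {θ | F s θ = some f}) * S.A f (x s) τ := by
  by_cases hf : x s ∈ S.flaw f
  · have := hX.step s x (Function.update h s (some f)) f (by simp) τ
    have hset : {θ | ∀ r ≤ s, X r θ = x r ∧ F r θ = Function.update h s (some f) r} =
        history X F x h s ∩ {θ | F s θ = some f} := by
      ext θ
      constructor
      · intro hθ
        refine ⟨⟨fun r hr => ?_, (hθ s le_rfl).1⟩, by simpa using (hθ s le_rfl).2⟩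
        simpa [hr.ne] using hθ r hr.le
      · rintro ⟨⟨h1, h2⟩, h3⟩ r hr
        rcases hr.lt_or_eq with hr | rfl
        · simpa [hr.ne] using h1 r hr
        · simpa using ⟨h2, h3⟩
    rw [Set.ofPred_and, hset] at this
    simpa [A, hf] using this
  -- A flaw absent from `x s` is almost surely not selected, matching the zero row of `A`.
  · have h0 : P (history X F x h s ∩ {θ | F s θ = some f}) = 0 := by
      refine measure_mono_null (fun θ hθ => ?_) (ae_iff.1 (hX.select s))
      simp only [Set.mem_ofPred_eq, not_forall]
      exact ⟨f, hθ.2, by rw [hθ.1.2]; exact hf⟩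
    rw [h0, zero_mul]
    exact measure_mono_null Set.inter_subset_left h0

theorem measure_hitList_le_of_mem {x : ℕ → Ω} {s : ℕ} (hE : x s ∈ E) (h : ℕ → Option 𝓕) (k : ℕ)
    (l₀ : List 𝓕) :
    P (history X F x h s ∩ {θ | ∃ l, S.hitList E X F k s θ = some l ∧ S.cls l = S.cls l₀}) ≤
      P (history X F x h s) * S.listCol l₀ E (x s) := by
  by_cases hl : l₀ = []
  · subst hl
    refine (measure_mono Set.inter_subset_left).trans_eq ?_
    simp [listCol, eVec, hE]
  · refine le_of_eq_of_le ?_ zero_le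
    refine measure_mono_null ?_ (measure_empty (μ := P))
    rintro θ ⟨⟨-, hs⟩, l, hl1, hl2⟩
    rw [hitList_of_mem (by rwa [hs]), Option.some_inj] at hl1
    subst hl1
    exact hl (perm_of_cls_eq hl2).nil_eq.symm

/-- Given the history, the probability that `E` is hit with a prescribed explored wdag is at most
the corresponding entry of its column vector. -/
theorem IsExecution.measure_hitList_le [Countable Ω] [Countable 𝓕] (hT : S.TCommutative)
    (hX : S.IsExecution P X F) (k s : ℕ) (x : ℕ → Ω) (h : ℕ → Option 𝓕) (l₀ : List 𝓕) :
    P (history X F x h s ∩ {θ | ∃ l, S.hitList E X F k s θ = some l ∧ S.cls l = S.cls l₀}) ≤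
      P (history X F x h s) * S.listCol l₀ E (x s) := by
  induction k generalizing s x h l₀ with
  | zero =>
    by_cases hE : x s ∈ E
    · exact measure_hitList_le_of_mem hE h 0 l₀
    · refine le_of_eq_of_le ?_ zero_le
      refine measure_mono_null ?_ (measure_empty (μ := P))
      rintro θ ⟨⟨-, hs⟩, l, hl1, hl2⟩
      rw [hitList_zero_of_notMem (by rwa [hs])] at hl1
      cases hl1
  | succ k ih =>
    by_cases hE : x s ∈ E
    · exact measure_hitList_le_of_mem hE h _ l₀
    -- The last factor does not depend on `f`; this is what makes the estimate uniform over
    -- selection rules.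
    have key : ∀ f : 𝓕, P (history X F x h s ∩ {θ | F s θ = some f} ∩
        {θ | ∃ l, S.hitList E X F k (s + 1) θ = some l ∧
          S.cls (S.explore E f l) = S.cls l₀}) ≤
        P (history X F x h s ∩ {θ | F s θ = some f}) * S.listCol l₀ E (x s) := by
      intro f
      obtain ⟨l₁, hl₁⟩ := explore_cases (E := E) hT f l₀
      -- If the inequality fails, no list `l` leads to the target class, and the event is empty.
      by_cases hle : S.listCol (f :: l₁) E ≤ S.listCol l₀ E
      swap
      · refine le_of_eq_of_le ?_ zero_le
        refine measure_mono_null ?_ (measure_empty (μ := P))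
        rintro θ ⟨-, l, -, hl⟩
        exact hle (hl₁ l hl).2
      calc _ ≤ P (⋃ τ, history X F (Function.update x (s + 1) τ)
              (Function.update h s (some f)) (s + 1) ∩
              {θ | ∃ l, S.hitList E X F k (s + 1) θ = some l ∧ S.cls l = S.cls l₁}) := by
            refine measure_mono ?_
            rintro θ ⟨hθ, l, hl, hl'⟩
            refine Set.mem_iUnion.2 ⟨X (s + 1) θ, ?_, l, hl, (hl₁ l hl').1⟩
            rw [← history_succ]
            exact ⟨hθ, rfl⟩
        _ ≤ ∑' τ, P (history X F x h s ∩ {θ | F s θ = some f}) * S.A f (x s) τ *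
              S.listCol l₁ E τ := by
            refine (measure_iUnion_le _).trans (ENNReal.tsum_le_tsum fun τ => ?_)
            refine (ih _ _ _ _).trans_eq ?_
            rw [← history_succ, hX.measure_step, Function.update_self]
        _ = P (history X F x h s ∩ {θ | F s θ = some f}) * S.listCol (f :: l₁) E (x s) := by
            simp only [mul_assoc, ENNReal.tsum_mul_left]
            rfl
        _ ≤ _ := mul_le_mul_right (hle _) _
    calc _ ≤ P (⋃ f, history X F x h s ∩ {θ | F s θ = some f} ∩
          {θ | ∃ l, S.hitList E X F k (s + 1) θ = some l ∧
            S.cls (S.explore E f l) = S.cls l₀}) := by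
          refine measure_mono ?_
          rintro θ ⟨hθ, l, hl, hl'⟩
          rw [hitList_succ_of_notMem (by rwa [hθ.2]), Option.bind_eq_some_iff] at hl
          obtain ⟨f, hf, hl⟩ := hl
          obtain ⟨l'', h1, rfl⟩ := Option.map_eq_some_iff.1 hl
          exact Set.mem_iUnion.2 ⟨f, ⟨hθ, hf⟩, l'', h1, hl'⟩
      _ ≤ ∑' f, P (history X F x h s ∩ {θ | F s θ = some f}) * S.listCol l₀ E (x s) :=
          (measure_iUnion_le _).trans (ENNReal.tsum_le_tsum key)
      -- Subadditivity points the wrong way here. The selection events are disjoint and measurable,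
      -- so their probabilities add up to at most that of the history.
      _ = P (⋃ f, history X F x h s ∩ {θ | F s θ = some f}) * S.listCol l₀ E (x s) := by
          rw [ENNReal.tsum_mul_right, measure_iUnion]
          · intro f g hfg
            rw [Function.onFun, Set.disjoint_left]
            rintro θ ⟨-, h1⟩ ⟨-, h2⟩
            exact hfg (Option.some_inj.1 (h1.symm.trans h2))
          · exact fun f => (hX.measurableSet_history x h s).inter (hX.measurable_sel s _)
      _ ≤ _ := mul_le_mul_left (measure_mono (Set.iUnion_subset fun f => Set.inter_subset_left)) _

/-- The probability that `E` is hit with a prescribed explored wdag. -/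
theorem IsExecution.measure_hitList_le_matWeight [Countable Ω] [Countable 𝓕]
    (hT : S.TCommutative) (hX : S.IsExecution P X F) (k : ℕ) (H : S.WdagClass) :
    P {θ | ∃ l, S.hitList E X F k 0 θ = some l ∧ S.cls l = H} ≤ S.matWeight H E := by
  obtain ⟨l₀, rfl, -⟩ := H.exists_list
  calc _ ≤ P (⋃ σ, history X F (fun _ => σ) (fun _ => none) 0 ∩
        {θ | ∃ l, S.hitList E X F k 0 θ = some l ∧ S.cls l = S.cls l₀}) :=
        measure_mono fun θ hθ => Set.mem_iUnion.2 ⟨X 0 θ, ⟨by simp, rfl⟩, hθ⟩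
    _ ≤ ∑' σ, S.μ σ * S.listCol l₀ E σ := by
        refine (measure_iUnion_le _).trans (ENNReal.tsum_le_tsum fun σ => ?_)
        refine (hX.measure_hitList_le hT k 0 _ _ l₀).trans_eq ?_
        rw [← hX.init σ]
        simp [history]
    _ = _ := by
        simp only [matWeight, mulCol_rep_cls hT]
        rfl

instance [Countable 𝓕] : Countable S.WdagClass :=
  Function.Surjective.countable (f := S.cls) fun H =>
    let ⟨l, hl, _⟩ := H.exists_list
    ⟨l, hl.symm⟩

/-- The probability that `E` is ever hit is at most the sum of the weights of the wdags with
orderable sink sets. -/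
theorem IsExecution.everProb_le_tsum_matWeight [Countable Ω] [Countable 𝓕]
    (hT : S.TCommutative) (hX : S.IsExecution P X F) (E : Set Ω) :
    everProb P X E ≤ ∑' I : S.orderables E, ∑' H : S.wdags I, S.matWeight H E := by
  have hae : {θ | ∃ t, X t θ ∈ E} ≤ᵐ[P] ⋃ k, {θ | S.hitList E X F k 0 θ ≠ none} := by
    filter_upwards [ae_all_iff.2 hX.select, ae_all_iff.2 hX.halt] with θ h1 h2 ⟨t, ht⟩
    exact Set.mem_iUnion.2 ⟨t, hitList_ne_none h1 h2 (by simpa using ht)⟩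
  refine (measure_mono_ae hae).trans ?_
  have hmono : Monotone fun k => {θ | S.hitList E X F k 0 θ ≠ none} :=
    monotone_nat_of_le_succ fun k θ hθ => hitList_ne_none_succ (k := k) hθ
  rw [hmono.directed_le.measure_iUnion]
  refine iSup_le fun k => ?_
  calc _ ≤ P (⋃ I : S.orderables E, ⋃ H : S.wdags I,
        {θ | ∃ l, S.hitList E X F k 0 θ = some l ∧ S.cls l = H}) := by
        refine measure_mono fun θ hθ => ?_
        obtain ⟨l, hl⟩ := Option.ne_none_iff_exists'.1 hθ
        obtain ⟨I, hI, hlI⟩ := (explored_of_hitList hl).exists_orderable hT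
        exact Set.mem_iUnion.2 ⟨⟨I, hI⟩, Set.mem_iUnion.2 ⟨⟨_, hlI⟩, l, hl, rfl⟩⟩
    _ ≤ _ := (measure_iUnion_le _).trans <| ENNReal.tsum_le_tsum fun I =>
        (measure_iUnion_le _).trans <| ENNReal.tsum_le_tsum fun H =>
          hX.measure_hitList_le_matWeight hT k H

end LocalSearch

namespace LocalSearch

variable {Ω 𝓕 : Type*} {S : LocalSearch Ω 𝓕}

/-! ### Charges -/

/-- Where `μ τ > 0` this is the definition of the charge. Where `μ τ = 0` the right side vanishes
even for an infinite charge, so the left side must vanish too, by `SupportClosed`. -/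
theorem tsum_μ_mul_A_le (hS : S.SupportClosed) (f : 𝓕) (τ : Ω) :
    ∑' σ, S.μ σ * S.A f σ τ ≤ S.charge f * S.μ τ := by
  by_cases hτ : S.μ τ = 0
  · refine le_of_eq_of_le (ENNReal.tsum_eq_zero.2 fun σ => ?_) zero_le
    by_cases hσ : S.μ σ = 0
    · rw [hσ, zero_mul]
    · rw [hS f σ τ hσ hτ, mul_zero]
  · refine (ENNReal.div_le_iff_le_mul (.inl hτ) (.inl (S.μ.apply_ne_top τ))).1 ?_
    refine le_trans (le_of_eq ?_) (le_iSup (fun τ => ∑' σ, S.μ σ / S.μ τ * S.A f σ τ) τ)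
    rw [div_eq_mul_inv, ← ENNReal.tsum_mul_right]
    exact tsum_congr fun σ => by rw [div_eq_mul_inv, mul_right_comm]

theorem tsum_μ_mulCol_le (hS : S.SupportClosed) (f : 𝓕) (v : Ω → ℝ≥0∞) :
    ∑' σ, S.μ σ * mulCol (S.A f) v σ ≤ S.charge f * ∑' τ, S.μ τ * v τ := by
  simp only [mulCol, ← ENNReal.tsum_mul_left]
  rw [ENNReal.tsum_comm]
  refine ENNReal.tsum_le_tsum fun τ => ?_
  simp only [← mul_assoc, ENNReal.tsum_mul_right]
  exact mul_le_mul_left (tsum_μ_mul_A_le hS f τ) _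

theorem tsum_μ_applyList_le (hS : S.SupportClosed) (l : List 𝓕) (v : Ω → ℝ≥0∞) :
    ∑' σ, S.μ σ * S.applyList l v σ ≤ (l.map S.charge).prod * ∑' τ, S.μ τ * v τ := by
  induction l with
  | nil => simp [applyList]
  | cons f l ih =>
    rw [applyList_cons, List.map_cons, List.prod_cons, mul_assoc]
    exact (tsum_μ_mulCol_le hS f _).trans (mul_le_mul_right ih _)

theorem weight_mk {n : ℕ} (K : S.Wdag n) :
    S.weight (Quotient.mk S.wdagSetoid ⟨n, K⟩) = ∏ v, S.charge (K.label v) :=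
  (rep_iso_of_eq rfl).prod_eq S.charge

theorem weight_cls (l : List 𝓕) : S.weight (S.cls l) = (l.map S.charge).prod := by
  rw [cls, weight_mk]
  exact Fin.prod_univ_fun_getElem l S.charge

theorem tsum_μ_eVec (E : Set Ω) : ∑' σ, S.μ σ * eVec E σ = S.μ.toOuterMeasure E := by
  rw [PMF.toOuterMeasure_apply]
  refine tsum_congr fun σ => ?_
  by_cases h : σ ∈ E <;> simp [eVec, h]

theorem matWeight_le (hT : S.TCommutative) (hS : S.SupportClosed) (H : S.WdagClass) (E : Set Ω) :
    S.matWeight H E ≤ S.μ.toOuterMeasure E * S.weight H := by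
  obtain ⟨l, rfl, -⟩ := H.exists_list
  rw [matWeight, mulCol_rep_cls hT, weight_cls, ← tsum_μ_eVec, mul_comm]
  exact tsum_μ_applyList_le hS l _

theorem tsum_matWeight_le (hT : S.TCommutative) (hS : S.SupportClosed) (E : Set Ω) :
    ∑' I : S.orderables E, ∑' H : S.wdags I, S.matWeight H E ≤
      S.μ.toOuterMeasure E * ∑' I : S.orderables E, S.Psi I := by
  rw [← ENNReal.tsum_mul_left]
  refine ENNReal.tsum_le_tsum fun I => ?_
  rw [Psi, ← ENNReal.tsum_mul_left]
  exact ENNReal.tsum_le_tsum fun H => matWeight_le hT hS H E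

theorem tsum_orderables_le (E : Set Ω) (w : Finset 𝓕 → ℝ≥0∞) :
    ∑' I : S.orderables E, w I ≤
      ∑' J : {J : Finset 𝓕 // (J : Set 𝓕) ⊆ S.causes E}, w J :=
  ENNReal.tsum_mono_subtype w (s := S.orderables E)
    (t := {J : Finset 𝓕 | (J : Set 𝓕) ⊆ S.causes E}) fun _ hI => hI.2.1

/-- A transition out of the support puts an infinite term into the charge, so the scalar criteria,
which force finite charges, need no separate support assumption. -/
theorem supportClosed_of_charge_ne_top (h : ∀ f, S.charge f ≠ ⊤) : S.SupportClosed := by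
  intro f σ τ hσ hτ
  by_contra hA
  refine h f (top_le_iff.1 ?_)
  calc ⊤ = S.μ σ / S.μ τ * S.A f σ τ := by
        rw [hτ, ENNReal.div_zero hσ, ENNReal.top_mul hA]
    _ ≤ ∑' σ, S.μ σ / S.μ τ * S.A f σ τ :=
        ENNReal.le_tsum (f := fun σ => S.μ σ / S.μ τ * S.A f σ τ) σ
    _ ≤ S.charge f := le_iSup (fun τ => ∑' σ, S.μ σ / S.μ τ * S.A f σ τ) τ

/-! ### Cluster expansion -/

/-- The number of vertices. -/
noncomputable def WdagClass.size (H : S.WdagClass) : ℕ := (Quotient.out H).1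

theorem Wdag.exists_iso_sink {n : ℕ} (H : S.Wdag n) {g : 𝓕} (hg : g ∈ H.sink) :
    ∃ (k : ℕ) (K : S.Wdag (k + 1)) (v : Fin (k + 1)), K.IsSink v ∧ K.label v = g ∧ H.Iso K := by
  cases n with
  | zero => exact hg.choose.elim0
  | succ k =>
    obtain ⟨v, hv, rfl⟩ := hg
    exact ⟨k, H, v, hv, rfl, (S.wdagSetoid.refl ⟨_, H⟩ : H.Iso H)⟩

/-- The recursion step for `Ψ`: one factor `γ_g` is split off, and new sinks can appear only among
the neighbors of `g`. -/
theorem exists_removeSink (g : 𝓕) :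
    ∃ r : {H : S.WdagClass // g ∈ H.rep.sink} → S.WdagClass, Function.Injective r ∧
      ∀ H : {H : S.WdagClass // g ∈ H.rep.sink},
      S.weight H.1 = S.charge g * S.weight (r H) ∧ H.1.size = (r H).size + 1 ∧
      (r H).rep.sink ⊆ (H.1.rep.sink \ {g}) ∪ S.nbrIncl g ∧
      H.1.rep.sink \ {g} ⊆ (r H).rep.sink := by
  choose k K v hv hl hK using fun H : {H : S.WdagClass // g ∈ H.rep.sink} =>
    H.1.rep.exists_iso_sink H.2
  have hr : ∀ H, (WdagClass.rep (S := S) (Quotient.mk S.wdagSetoid ⟨k H, (K H).delete (v H)⟩)).Iso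
      ((K H).delete (v H)) := fun H => rep_iso_of_eq rfl
  refine ⟨fun H => Quotient.mk S.wdagSetoid ⟨k H, (K H).delete (v H)⟩, fun H H' h => ?_,
    fun H => ⟨?_, ?_, ?_, ?_⟩⟩
  · have h1 : ((K H).delete (v H)).Iso ((K H').delete (v H')) :=
      (Quotient.eq (r := S.wdagSetoid)).1 h
    have h2 := Wdag.iso_of_delete_sink (hv H) (hv H') ((hl H').trans (hl H).symm) h1
    exact Subtype.ext (eq_of_rep_iso (((hK H).trans h2).trans (hK H').symm))
  · rw [weight_mk, weight, (hK H).prod_eq S.charge, Fin.prod_univ_succAbove _ (v H), hl]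
    rfl
  · exact (hK H).size_eq.trans (congrArg (· + 1) (hr H).size_eq.symm)
  · rw [(hr H).sink_eq, (hK H).sink_eq, ← hl H]
    exact (K H).sink_delete_subset
  · rw [(hr H).sink_eq, (hK H).sink_eq, ← hl H]
    exact (K H).subset_sink_delete

theorem WdagClass.eq_cls_nil {H : S.WdagClass} (h : H.rep.sink = ∅) : H = S.cls [] := by
  obtain ⟨l, rfl, -⟩ := H.exists_list
  cases l with
  | nil => rfl
  | cons f l =>
    rw [(rep_iso_of_eq (rfl : S.cls (f :: l) = _)).sink_eq] at h
    obtain ⟨v, hv⟩ := (Wdag.ofWord S (f :: l).get).exists_isSink (n := l.length)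
    exact absurd (h ▸ ⟨v, hv, rfl⟩ : (f :: l).get v ∈ (∅ : Set 𝓕)) (Set.notMem_empty _)

open Classical in
/-- Under the cluster-expansion criterion, the total weight of the wdags of bounded size with a
given stable sink set is at most the product of the `η` over that set. -/
theorem tsum_weight_size_le {η : 𝓕 → ℝ≥0} (hη : S.ClusterCrit η) (n : ℕ) (I : Finset 𝓕)
    (hI : S.Stable I) :
    ∑' H : {H : S.WdagClass | H ∈ S.wdags I ∧ H.size ≤ n}, S.weight H ≤
      ∏ g ∈ I, (η g : ℝ≥0∞) := by
  induction n generalizing I with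
  | zero | succ n ih => ?_
  all_goals
    -- A wdag without sinks is empty and has weight `1`; this settles `I = ∅` for every size bound.
    rcases I.eq_empty_or_nonempty with rfl | ⟨g, hg⟩
    · calc _ ≤ ∑' H : ((({S.cls []} : Finset S.WdagClass) : Set S.WdagClass)), S.weight H := by
            refine ENNReal.tsum_mono_subtype S.weight fun H hH => ?_
            have hs : H.rep.sink = _ := hH.1
            simpa using H.eq_cls_nil (by simpa using hs)
        _ ≤ _ := by
            rw [Finset.tsum_subtype']
            simp [weight_cls]
  · have : IsEmpty {H : S.WdagClass | H ∈ S.wdags I ∧ H.size ≤ 0} := by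
      refine ⟨fun ⟨H, hH, h0⟩ => ?_⟩
      have hs : g ∈ H.rep.sink := by rw [show H.rep.sink = _ from hH]; exact hg
      obtain ⟨r, -, hr⟩ := exists_removeSink (S := S) g
      have := (hr ⟨H, hs⟩).2.1
      simp only at this
      omega
    rw [tsum_empty]
    exact zero_le
  · obtain ⟨r, hinj, hr⟩ := exists_removeSink (S := S) g
    have hs : ∀ H : {H : S.WdagClass | H ∈ S.wdags I ∧ H.size ≤ n + 1}, g ∈ H.1.rep.sink := by
      intro H
      rw [show H.1.rep.sink = _ from H.2.1]; exact hg
    -- `J` is the set of sinks that appear when `g` is removed. Taking it disjoint from `I.erase g`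
    -- lets the product of the `η` split.
    let T : Set (Finset 𝓕) := {J | ((J : Set 𝓕) ⊆ S.nbrIncl g ∧ S.Stable J) ∧
      Disjoint (I.erase g) J ∧ S.Stable (I.erase g ∪ J)}
    let W : T → Set S.WdagClass := fun J =>
      {H | H ∈ S.wdags (I.erase g ∪ J) ∧ H.size ≤ n}
    have hW : ∀ H : {H : S.WdagClass | H ∈ S.wdags I ∧ H.size ≤ n + 1},
        r ⟨H, hs H⟩ ∈ ⋃ J, W J := by
      intro H
      obtain ⟨-, h2, h3, h4⟩ := hr ⟨H, hs H⟩
      have hH : H.1.rep.sink = (I : Set 𝓕) := H.2.1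
      simp only [hH] at h2 h3 h4
      set K := r ⟨H, hs H⟩
      have hK : K.rep.sink = ((I.erase g ∪ (K.rep.sink_finite.toFinset \ I.erase g) :
          Finset 𝓕) : Set 𝓕) := by
        rw [Finset.union_sdiff_self_eq_union]
        ext f
        have := @h4 f
        simp at this ⊢
        tauto
      refine Set.mem_iUnion.2 ⟨⟨K.rep.sink_finite.toFinset \ I.erase g, ⟨⟨?_, ?_⟩, ?_, ?_⟩⟩, hK, ?_⟩
      · intro f hf
        simp only [Finset.coe_sdiff, Set.Finite.coe_toFinset, Finset.coe_erase] at hf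
        exact (h3 hf.1).resolve_left hf.2
      · intro f hf f' hf' hne
        refine K.rep.sink_stable ?_ ?_ hne
        · simpa using (Finset.mem_sdiff.1 hf).1
        · simpa using (Finset.mem_sdiff.1 hf').1
      · exact Finset.disjoint_sdiff
      · intro f hf f' hf' hne
        refine K.rep.sink_stable ?_ ?_ hne <;> rw [hK] <;> assumption
      · have := H.2.2
        omega
    calc _ = ∑' H : {H : S.WdagClass | H ∈ S.wdags I ∧ H.size ≤ n + 1},
          S.charge g * S.weight (r ⟨H, hs H⟩) :=
          tsum_congr fun H => (hr ⟨H, hs H⟩).1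
      _ = S.charge g * ∑' H : {H : S.WdagClass | H ∈ S.wdags I ∧ H.size ≤ n + 1},
          S.weight (r ⟨H, hs H⟩) := ENNReal.tsum_mul_left
      _ ≤ S.charge g * ∑' K : (⋃ J, W J : Set S.WdagClass), S.weight K := by
          refine mul_le_mul_right ?_ _
          refine ENNReal.tsum_comp_le_tsum_of_injective
            (f := fun H : {H : S.WdagClass | H ∈ S.wdags I ∧ H.size ≤ n + 1} => (⟨r ⟨H, hs H⟩, hW H⟩ : (⋃ J, W J : Set S.WdagClass)))
            (fun H H' h => ?_) (fun K => S.weight K)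
          have := congrArg Subtype.val (hinj (congrArg Subtype.val h))
          exact Subtype.ext this
      _ ≤ S.charge g * ∑' J : T, ∏ f ∈ I.erase g ∪ J, (η f : ℝ≥0∞) := by
          refine mul_le_mul_right ((ENNReal.tsum_iUnion_le_tsum _ _).trans ?_) _
          exact ENNReal.tsum_le_tsum fun J => ih _ J.2.2.2
      _ = S.charge g * ∑' J : T, (∏ f ∈ I.erase g, (η f : ℝ≥0∞)) * ∏ f ∈ J.1, (η f : ℝ≥0∞) := by
          congr 1
          exact tsum_congr fun J => Finset.prod_union J.2.2.1
      _ = (S.charge g * ∑' J : T, ∏ f ∈ J.1, (η f : ℝ≥0∞)) *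
          ∏ f ∈ I.erase g, (η f : ℝ≥0∞) := by
          rw [ENNReal.tsum_mul_left]; ring
      _ ≤ η g * ∏ f ∈ I.erase g, (η f : ℝ≥0∞) := by
          refine mul_le_mul_left (le_trans (mul_le_mul_right ?_ _) (hη g)) _
          exact ENNReal.tsum_mono_subtype (fun J : Finset 𝓕 => ∏ f ∈ J, (η f : ℝ≥0∞)) (s := T)
            (t := {I : Finset 𝓕 | (I : Set 𝓕) ⊆ S.nbrIncl g ∧ S.Stable I}) fun J hJ => hJ.1
      _ = _ := Finset.mul_prod_erase I (fun f => (η f : ℝ≥0∞)) hg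

/-- Each finite partial sum of `Ψ` involves wdags of bounded size only. -/
theorem Psi_le_prod {η : 𝓕 → ℝ≥0} (hη : S.ClusterCrit η) {I : Finset 𝓕} (hI : S.Stable I) :
    S.Psi I ≤ ∏ g ∈ I, (η g : ℝ≥0∞) := by
  rw [Psi, ENNReal.tsum_eq_iSup_sum]
  refine iSup_le fun s => ?_
  refine le_trans ?_ (tsum_weight_size_le hη (s.sup fun H => H.1.size) I hI)
  have hs := Finset.sum_map s (Function.Embedding.subtype fun H => H ∈ S.wdags I) S.weight
  refine hs.symm.trans_le ?_
  rw [← Finset.tsum_subtype']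
  refine ENNReal.tsum_mono_subtype S.weight fun H hH => ?_
  simp only [Finset.coe_map, Function.Embedding.subtype_apply, Set.mem_image] at hH
  obtain ⟨H, hH, rfl⟩ := hH
  exact ⟨H.2, Finset.le_sup (f := fun H : S.wdags I => H.1.size) hH⟩

/-- The empty set contributes `1` to the sum in the criterion, so `γ_f ≤ η f < ∞`. -/
theorem ClusterCrit.charge_ne_top {η : 𝓕 → ℝ≥0} (hη : S.ClusterCrit η) (f : 𝓕) :
    S.charge f ≠ ⊤ := by
  refine ne_top_of_le_ne_top ENNReal.coe_ne_top (le_trans ?_ (hη f))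
  refine le_mul_of_one_le_right' ?_
  refine le_trans (le_of_eq ?_) (ENNReal.le_tsum ⟨∅, by simp, fun f hf => by simp at hf⟩)
  simp

end LocalSearch

/-! ### Infinite products and subset sums in `ℝ≥0∞` -/

namespace ENNReal

variable {α : Type*}

-- Finite products of factors at least `1` increase to their supremum, so the infinite product
-- converges and is not the default value.
open Classical in
theorem prod_le_tprod_of_one_le {T : Set α} {a : α → ℝ≥0∞} (ha : ∀ i, 1 ≤ a i) {U : Finset α}
    (hU : (U : Set α) ⊆ T) : ∏ i ∈ U, a i ≤ ∏' i : T, a i := by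
  have h : HasProd (fun i : T => a i) _ :=
    hasProd_of_isLUB_of_one_le _ (fun i => ha i) (isLUB_sSup _)
  have hle := h.multipliable.prod_le_tprod (U.subtype (· ∈ T)) fun i _ => ha i
  rwa [Finset.prod_subtype_of_mem a fun x hx => hU hx] at hle

open Classical in
theorem tprod_le_prod_of_le_one {T : Set α} {a : α → ℝ≥0∞} (ha : ∀ i, a i ≤ 1) {U : Finset α}
    (hU : (U : Set α) ⊆ T) : ∏' i : T, a i ≤ ∏ i ∈ U, a i := by
  have h : HasProd (fun i : T => a i) _ :=
    hasProd_of_isGLB_of_le_one _ (fun i => ha i) (isGLB_sInf _)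
  rw [h.tprod_eq, ← Finset.prod_subtype_of_mem a fun x hx => hU hx]
  exact sInf_le ⟨_, rfl⟩

-- Finitely many finite subsets of `T` lie in one finite `U`, and expanding `∏ (1 + η)` over `U`
-- gives the sum over all subsets of `U`.
open Classical in
theorem mul_tsum_prod_le {T : Set α} {η : α → ℝ≥0∞} {c B : ℝ≥0∞}
    (h : ∀ U : Finset α, (U : Set α) ⊆ T → c * ∏ i ∈ U, (1 + η i) ≤ B) :
    c * ∑' I : {I : Finset α // (I : Set α) ⊆ T}, ∏ i ∈ I.1, η i ≤ B := by
  rw [← ENNReal.tsum_mul_left, ENNReal.tsum_eq_iSup_sum]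
  refine iSup_le fun s => ?_
  rw [← Finset.mul_sum]
  refine le_trans (mul_le_mul_right ?_ _) (h (s.biUnion fun I => I.1) ?_)
  · rw [Finset.prod_one_add]
    refine (Finset.sum_map s (Function.Embedding.subtype fun I : Finset α => (I : Set α) ⊆ T)
      fun I => ∏ i ∈ I, η i).symm.trans_le (Finset.sum_le_sum_of_subset fun I hI => ?_)
    obtain ⟨J, hJ, rfl⟩ := Finset.mem_map.1 hI
    exact Finset.mem_powerset.2 (Finset.subset_biUnion_of_mem (fun I : {I : Finset α //
      (I : Set α) ⊆ T} => I.1) hJ)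
  · intro i hi
    obtain ⟨I, -, hI⟩ := Finset.mem_biUnion.1 (Finset.mem_coe.1 hi)
    exact I.2 hI

theorem one_add_le_exp (a : ℝ≥0∞) : 1 + a ≤ EReal.exp (a : EReal) := by
  induction a with
  | top => simp
  | coe a =>
    have : ((a : ℝ≥0∞) : EReal) = ((a : ℝ) : EReal) := rfl
    rw [this, EReal.exp_coe]
    refine le_of_eq_of_le ?_ (ENNReal.ofReal_le_ofReal (Real.add_one_le_exp (a : ℝ)))
    rw [ENNReal.ofReal_add (NNReal.coe_nonneg a) zero_le_one, ENNReal.ofReal_coe_nnreal, ENNReal.ofReal_one, add_comm]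

theorem prod_one_add_le_exp_sum (U : Finset α) (η : α → ℝ≥0∞) :
    ∏ i ∈ U, (1 + η i) ≤ EReal.exp ((∑ i ∈ U, η i : ℝ≥0∞) : EReal) := by
  classical
  induction U using Finset.induction_on with
  | empty => simp
  | insert i U hi ih =>
    rw [Finset.prod_insert hi, Finset.sum_insert hi, EReal.coe_ennreal_add, EReal.exp_add]
    exact mul_le_mul' (one_add_le_exp _) ih

theorem prod_one_add_le_exp_tsum {T : Set α} {U : Finset α} (hU : (U : Set α) ⊆ T)
    (η : α → ℝ≥0∞) :
    ∏ i ∈ U, (1 + η i) ≤ EReal.exp ((∑' i : T, η i : ℝ≥0∞) : EReal) := by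
  refine (prod_one_add_le_exp_sum U η).trans (EReal.exp_monotone ?_)
  rw [EReal.coe_ennreal_le_coe_ennreal_iff, ← Finset.tsum_subtype']
  exact ENNReal.tsum_mono_subtype η hU

theorem exp_coe_one : EReal.exp ((1 : ℝ≥0∞) : EReal) = ENNReal.ofReal (Real.exp 1) := by
  rw [EReal.coe_ennreal_one, ← EReal.coe_one, EReal.exp_coe]

end ENNReal

/-! ### The scalar criteria as cases of cluster expansion -/

namespace LocalSearch

variable {Ω 𝓕 : Type*} {S : LocalSearch Ω 𝓕}

/-- Dropping the stability of `I` only enlarges the sum, which is then controlled by the finite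
products of `1 + η`. -/
theorem clusterCrit_of_forall_finset {η : 𝓕 → ℝ≥0}
    (h : ∀ f, ∀ U : Finset 𝓕, (U : Set 𝓕) ⊆ S.nbrIncl f →
      S.charge f * ∏ g ∈ U, (1 + (η g : ℝ≥0∞)) ≤ η f) : S.ClusterCrit η := by
  intro f
  refine le_trans (mul_le_mul_right ?_ _) (ENNReal.mul_tsum_prod_le (h f))
  exact ENNReal.tsum_mono_subtype (fun J : Finset 𝓕 => ∏ f ∈ J, (η f : ℝ≥0∞))
    (s := {I : Finset 𝓕 | (I : Set 𝓕) ⊆ S.nbrIncl f ∧ S.Stable I})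
    (t := {I : Finset 𝓕 | (I : Set 𝓕) ⊆ S.nbrIncl f}) fun J hJ => hJ.1

theorem SymmetricCrit.exp_mul_le {p d : ℝ≥0} (h : S.SymmetricCrit p d) (f : 𝓕) :
    ∑' _ : S.nbrIncl f, ENNReal.ofReal (Real.exp 1) * p ≤ 1 := by
  rw [ENNReal.tsum_set_const, mul_comm]
  refine (mul_le_mul_right (h.2 f).2 _).trans ?_
  rw [← ENNReal.ofReal_coe_nnreal (p := p), ← ENNReal.ofReal_coe_nnreal (p := d),
    ← ENNReal.ofReal_mul (Real.exp_nonneg _), ← ENNReal.ofReal_mul (by positivity)]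
  exact ENNReal.ofReal_le_one.2 h.1

/-- With `η = e p`, the product of `1 + η` over a neighborhood is at most `exp (e p d) ≤ e`, and `p
· e = η`. -/
theorem SymmetricCrit.clusterCrit {p d : ℝ≥0} (h : S.SymmetricCrit p d) :
    S.ClusterCrit fun _ => (Real.exp 1).toNNReal * p := by
  refine clusterCrit_of_forall_finset fun f U hU => ?_
  rw [ENNReal.coe_mul, mul_comm ((Real.exp 1).toNNReal : ℝ≥0∞)]
  refine mul_le_mul' (h.2 f).1 ((ENNReal.prod_one_add_le_exp_tsum hU _).trans ?_)
  change _ ≤ ENNReal.ofReal (Real.exp 1)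
  rw [← ENNReal.exp_coe_one]
  refine EReal.exp_monotone (EReal.coe_ennreal_le_coe_ennreal_iff.2 ?_)
  refine le_of_eq_of_le (tsum_congr fun _ => ?_) (h.exp_mul_le f)
  rw [mul_comm]; rfl

theorem NeighborhoodCrit.charge_ne_top (h : S.NeighborhoodCrit) (f : 𝓕) : S.charge f ≠ ⊤ := by
  have h1 : S.charge f ≤ 1 / 4 := le_trans
    (ENNReal.le_tsum (f := fun g : S.nbrIncl f => S.charge g) ⟨f, S.rel_refl f⟩) (h f)
  exact ne_top_of_le_ne_top (by simp) h1

theorem NeighborhoodCrit.coe_toNNReal (h : S.NeighborhoodCrit) (f : 𝓕) :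
    ((4 * S.charge f).toNNReal : ℝ≥0∞) = 4 * S.charge f :=
  ENNReal.coe_toNNReal (ENNReal.mul_ne_top (by simp) (h.charge_ne_top f))

/-- With `η = 4 γ`, the product is at most `exp (4 · 1/4) = e ≤ 4`. -/
theorem NeighborhoodCrit.clusterCrit (h : S.NeighborhoodCrit) :
    S.ClusterCrit fun f => (4 * S.charge f).toNNReal := by
  refine clusterCrit_of_forall_finset fun f U hU => ?_
  simp only [h.coe_toNNReal]
  rw [mul_comm 4]
  refine mul_le_mul_right ((ENNReal.prod_one_add_le_exp_tsum hU _).trans ?_) _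
  calc _ ≤ EReal.exp ((1 : ℝ≥0∞) : EReal) := by
        refine EReal.exp_monotone (EReal.coe_ennreal_le_coe_ennreal_iff.2 ?_)
        rw [ENNReal.tsum_mul_left]
        refine (mul_le_mul_right (h f) _).trans_eq ?_
        rw [mul_one_div]
        exact ENNReal.div_self (by simp) (by simp)
    _ = ENNReal.ofReal (Real.exp 1) := ENNReal.exp_coe_one
    _ ≤ ENNReal.ofReal 4 :=
        ENNReal.ofReal_le_ofReal (Real.exp_one_lt_d9.le.trans (by norm_num))
    _ = 4 := by simp

theorem one_add_div_one_sub {x : ℝ≥0} (hx : x < 1) :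
    (1 : ℝ≥0∞) + (x / (1 - x) : ℝ≥0) = (1 - (x : ℝ≥0∞))⁻¹ := by
  have h0 : 1 - x ≠ 0 := (tsub_pos_of_lt hx).ne'
  rw [← ENNReal.coe_one, ← ENNReal.coe_sub, ← ENNReal.coe_inv h0, ← ENNReal.coe_add]
  congr 1
  rw [one_add_div h0, tsub_add_cancel_of_le hx.le, one_div]

-- With `η = x / (1 - x)` one has `1 + η = 1 / (1 - x)`. The factors over `Γ(f)` cancel against the
-- criterion, and the factor of `f` turns `x` into `η`.
open Classical in
theorem AsymmetricCrit.clusterCrit {x : 𝓕 → ℝ≥0} (h : S.AsymmetricCrit x) :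
    S.ClusterCrit fun f => x f / (1 - x f) := by
  refine clusterCrit_of_forall_finset fun f U hU => ?_
  have hne : ∀ g, (1 - (x g : ℝ≥0∞)) ≠ 0 := fun g =>
    (tsub_pos_of_lt (ENNReal.coe_lt_one_iff.2 (h.1 g))).ne'
  have htop : ∀ g, (1 - (x g : ℝ≥0∞)) ≠ ⊤ := fun g =>
    ne_top_of_le_ne_top ENNReal.one_ne_top tsub_le_self
  simp only [fun g => one_add_div_one_sub (h.1 g)]
  have h1 : ∏' g : S.nbr f, (1 - (x g : ℝ≥0∞)) ≤ ∏ g ∈ U.erase f, (1 - (x g : ℝ≥0∞)) := by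
    refine ENNReal.tprod_le_prod_of_le_one (fun _ => tsub_le_self) fun g hg => ?_
    have hg := Finset.mem_erase.1 (Finset.mem_coe.1 hg)
    exact ⟨hU hg.2, hg.1⟩
  -- `U` need not contain `f`; inserting it only enlarges the product, as every factor is at least
  -- `1`.
  have h2 : ∏ g ∈ U, (1 - (x g : ℝ≥0∞))⁻¹ ≤
      (1 - (x f : ℝ≥0∞))⁻¹ * ∏ g ∈ U.erase f, (1 - (x g : ℝ≥0∞))⁻¹ := by
    rw [← Finset.prod_insert (f := fun g => (1 - (x g : ℝ≥0∞))⁻¹) (Finset.notMem_erase f U)]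
    refine Finset.prod_le_prod_of_subset_of_one_le' (fun g hg => ?_) fun g _ _ =>
      ENNReal.one_le_inv.2 tsub_le_self
    by_cases hgf : g = f <;> simp [hgf, hg]
  calc _ ≤ (x f * ∏ g ∈ U.erase f, (1 - (x g : ℝ≥0∞))) *
        ((1 - (x f : ℝ≥0∞))⁻¹ * ∏ g ∈ U.erase f, (1 - (x g : ℝ≥0∞))⁻¹) :=
        mul_le_mul' ((h.2 f).trans (mul_le_mul_right h1 _)) h2
    _ = x f * (1 - (x f : ℝ≥0∞))⁻¹ *
        ∏ g ∈ U.erase f, ((1 - (x g : ℝ≥0∞)) * (1 - (x g : ℝ≥0∞))⁻¹) := by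
        rw [Finset.prod_mul_distrib]; ring
    _ = x f * (1 - (x f : ℝ≥0∞))⁻¹ := by
        rw [Finset.prod_eq_one fun g _ => ENNReal.mul_inv_cancel (hne g) (htop g), mul_one]
    _ = _ := by
        have h0 : 1 - x f ≠ 0 := (tsub_pos_of_lt (h.1 f)).ne'
        rw [ENNReal.coe_div h0, ENNReal.coe_sub, ENNReal.coe_one, div_eq_mul_inv]

theorem tsum_orderables_prod_le {E : Set Ω} {η : 𝓕 → ℝ≥0∞} {B : ℝ≥0∞}
    (h : ∀ U : Finset 𝓕, (U : Set 𝓕) ⊆ S.causes E → ∏ i ∈ U, (1 + η i) ≤ B) :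
    ∑' I : S.orderables E, ∏ g ∈ I.1, η g ≤ B := by
  refine (tsum_orderables_le E fun I => ∏ g ∈ I, η g).trans ?_
  have := ENNReal.mul_tsum_prod_le (c := 1) (B := B) (η := η) (T := S.causes E)
    (by simpa only [one_mul] using h)
  rwa [one_mul] at this

theorem IsExecution.everProb_le_of_clusterCrit [Countable Ω] [Countable 𝓕]
    (hT : S.TCommutative) {Θ : Type*} [MeasurableSpace Θ] {P : Measure Θ} {X : ℕ → Θ → Ω}
    {F : ℕ → Θ → Option 𝓕} (hX : S.IsExecution P X F) (E : Set Ω) {η : 𝓕 → ℝ≥0}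
    (hη : S.ClusterCrit η) :
    everProb P X E ≤ S.μ.toOuterMeasure E * ∑' I : S.orderables E, ∏ g ∈ I.1, (η g : ℝ≥0∞) :=
  (hX.everProb_le_tsum_matWeight hT E).trans <|
    (tsum_matWeight_le hT (supportClosed_of_charge_ne_top hη.charge_ne_top) E).trans <|
      mul_le_mul_right (ENNReal.tsum_le_tsum fun I => Psi_le_prod hη I.2.1) _

end LocalSearch

theorem theorem5p2 {Ω 𝓕 : Type*} [Countable Ω] [Countable 𝓕]
    (S : LocalSearch Ω 𝓕) (hT : S.TCommutative)
    {Θ : Type*} [MeasurableSpace Θ] (P : Measure Θ) [IsProbabilityMeasure P]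
    (X : ℕ → Θ → Ω) (F : ℕ → Θ → Option 𝓕) (hX : S.IsExecution P X F) (E : Set Ω) :
    LocalSearch.everProb P X E ≤
        ∑' I : S.orderables E, ∑' H : S.wdags I, S.matWeight H E ∧
    (S.SupportClosed →
      LocalSearch.everProb P X E ≤ S.μ.toOuterMeasure E * ∑' I : S.orderables E, S.Psi I ∧
      S.μ.toOuterMeasure E * ∑' I : S.orderables E, S.Psi I ≤
        S.μ.toOuterMeasure E * S.PsiBar (S.causes E)) ∧
    (∀ p d : ℝ≥0, S.SymmetricCrit p d →
      LocalSearch.everProb P X E ≤ S.μ.toOuterMeasure E *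
        EReal.exp ((ENNReal.ofReal (Real.exp 1) * (S.causes E).encard * p : ℝ≥0∞) : EReal)) ∧
    (S.NeighborhoodCrit →
      LocalSearch.everProb P X E ≤ S.μ.toOuterMeasure E *
        EReal.exp ((4 * ∑' f : S.causes E, S.charge f : ℝ≥0∞) : EReal)) ∧
    (∀ x : 𝓕 → ℝ≥0, S.AsymmetricCrit x →
      LocalSearch.everProb P X E ≤ S.μ.toOuterMeasure E *
        ∏' f : S.causes E, (1 - (x f : ℝ≥0∞))⁻¹) ∧
    (∀ η : 𝓕 → ℝ≥0, S.ClusterCrit η →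
      LocalSearch.everProb P X E ≤ S.μ.toOuterMeasure E *
        ∑' I : S.orderables E, ∏ g ∈ I.1, (η g : ℝ≥0∞)) := by
  refine ⟨hX.everProb_le_tsum_matWeight hT E, fun hS => ⟨?_, ?_⟩, fun p d h => ?_, fun h => ?_,
    fun x h => ?_, fun η h => hX.everProb_le_of_clusterCrit hT E h⟩
  · exact (hX.everProb_le_tsum_matWeight hT E).trans (LocalSearch.tsum_matWeight_le hT hS E)
  · exact mul_le_mul_right (LocalSearch.tsum_orderables_le E S.Psi) _
  · refine (hX.everProb_le_of_clusterCrit hT E h.clusterCrit).trans (mul_le_mul_right ?_ _)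
    refine LocalSearch.tsum_orderables_prod_le fun U hU =>
      (ENNReal.prod_one_add_le_exp_tsum hU _).trans_eq ?_
    rw [ENNReal.tsum_set_const, ENNReal.coe_mul, mul_left_comm, ← mul_assoc]
    rfl
  · refine (hX.everProb_le_of_clusterCrit hT E h.clusterCrit).trans (mul_le_mul_right ?_ _)
    refine LocalSearch.tsum_orderables_prod_le fun U hU =>
      (ENNReal.prod_one_add_le_exp_tsum hU _).trans_eq ?_
    simp only [h.coe_toNNReal, ENNReal.tsum_mul_left]
  · refine (hX.everProb_le_of_clusterCrit hT E h.clusterCrit).trans (mul_le_mul_right ?_ _)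
    refine LocalSearch.tsum_orderables_prod_le fun U hU => ?_
    simp only [fun g => LocalSearch.one_add_div_one_sub (h.1 g)]
    exact ENNReal.prod_le_tprod_of_one_le (a := fun g => (1 - (x g : ℝ≥0∞))⁻¹)
      (fun g => ENNReal.one_le_inv.2 tsub_le_self) hU
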